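/- **Conventions.** Let $K$ be a field of characteristic $0$ and let $A$ be a strict $A_\infty$-algebra over $K$: a $\mathbb Z$-graded space with multilinear operations $m_n:A[1]^{\otimes n}\to A[1]$, $n\ge 1$, of degree one such that $\sum(-1)^{|x_1|'+\dots+|x_{i-1}|'}m(x_1,\dots,x_{i-1},m(x_i,\dots,x_{i+r-1}),\dots,x_n)=0$ for all $n$ and all homogeneous $x_1,\dots,x_n$; $|\cdot|'$ is the degree in $A[1]$, and for a word $\vec a=(a_1,\dots,a_k)$ put $|\vec a|'=\sum|a_i|'$. An $A_\infty$-bimodule over $A$ is a $\mathbb Z$-graded space $C$ with operations $b_{k,l}:A[1]^{\otimes k}\otimes C\otimes A[1]^{\otimes l}\to C$ of degree one such that $b\circ\hat b=0$, where $\hat b$ is the map induced on $BA\otimes C\otimes BA$ by $m$ and $b$ with Koszul signs. An $A_\infty$-bimodule map $f:C\to D$ is a family $f_{k,l}:A[1]^{\otimes k}\otimes C\otimes A[1]^{\otimes l}\to D$ of degree zero such that $f\circ\hat b=b\circ\hat f$. It is a quasi-isomorphism if $f_{0,0}$ induces an isomorphism on $H^*$, the cohomology with respect to $b_{0,0}$.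 Fix $N\in\mathbb Z$. The dual bimodule $C^*$ is the graded dual of $C$, with degrees shifted so that a functional of degree $p$ is supported in degree $-N-p$ (so that a map $C\to C^*$ of degree zero is a pairing of degree $N$ on $C$), with operations $$b^*_{k,l}(\vec x,v^*,\vec y)(w)=(-1)^{1+|v^*|+|\vec x|'(|v^*|+|\vec y|'+|w|)}\,v^*\big(b_{l,k}(\vec y,w,\vec x)\big).$$ The dual $g^*:D^*\to C^*$ of a bimodule map $g:C\to D$ is $g^*_{k,l}(\vec x,v^*,\vec y)(w)=(-1)^{|\vec x|'(|v^*|+|\vec y|'+|w|)}v^*\big(g_{l,k}(\vec y,w,\vec x)\big)$. A *cyclic symmetric inner product* on a bimodule $D$ is an $A_\infty$-bimodule map $\psi:D\to D^*$ with $\psi_{k,l}=0$ for $(k,l)\ne(0,0)$ such that $\psi_{0,0}(v)(w)=-(-1)^{|v||w|}\psi_{0,0}(w)(v)$ and $\psi_{0,0}$ is non-degenerate, i.e. an isomorphism from $D$ onto the graded dual $D^*$. An $A_\infty$-bimodule map $\phi:C\to C^*$ is a *homotopy inner product* if there are an $A_\infty$-bimodule $D$ over $A$ with a cyclic symmetric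 inner product $\psi:D\to D^*$ and an $A_\infty$-bimodule quasi-isomorphism $g:C\to D$ such that $\phi=g^*\circ\psi\circ g$. **Theorem 4.1.** Let $C$ be an $A_\infty$-bimodule over $A$ whose cohomology $H^p(C)$ is finite dimensional for every $p$. Then there is a homotopy inner product $C\to C^*$ (of degree $N$) if and only if there is an $A_\infty$-bimodule map $\phi:C\to C^*$ (of the same degree $N$) such that 1. (skew symmetry) $\phi_{k,l}(\vec a,v,\vec b)(w)=-(-1)^{(|\vec a|'+|v|)(|\vec b|'+|w|)}\phi_{l,k}(\vec b,w,\vec a)(v)$ for all words $\vec a,\vec b$ of homogeneous elements of $A[1]$, of lengths $k,l\ge 0$, and all homogeneous $v,w\in C$; and 2. (homological non-degeneracy) for every non-zero $[a]\in H^*(C)$ there is $[b]\in H^*(C)$ with $\phi_{0,0}(a)(b)\ne 0$. -/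

import Mathlib

universe u v w w'

/-- A homogeneous element of a `ℤ`-graded space, recorded together with its degree. -/
abbrev Homog (V : ℤ → Type v) : Type v := Σ d : ℤ, V d

/-- The total degree of a word of homogeneous elements. -/
def wdeg {V : ℤ → Type v} (x : List (Homog V)) : ℤ := (x.map Sigma.fst).sum

/-- The map induced on words by a family `m` of operations of degree one:
`barSubst m x F` is the sum, over all factorisations `x = x₁ x₂ x₃` with `x₂` non-empty, of the Koszul
sign `(-1)^|x₁|` times `F (x₁, m x₂, x₃)`. In other words, it is the linear extension of `F`
evaluated on the image of `x` under the coderivation of the bar construction induced by `m`. -/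
def barSubst {V : ℤ → Type v} (m : List (Homog V) → ∀ q : ℤ, V q) {M : Type*} [AddCommGroup M]
    (x : List (Homog V)) (F : List (Homog V) → M) : M :=
  ∑ i ∈ Finset.range (x.length + 1), ∑ r ∈ Finset.Icc 1 (x.length - i),
    (wdeg (x.take i)).negOnePow •
      F (x.take i ++ ⟨wdeg ((x.drop i).take r) + 1,
        m ((x.drop i).take r) (wdeg ((x.drop i).take r) + 1)⟩ :: (x.drop i).drop r)

/-- A (strict) `A_∞`-algebra over `K`, in the degree shifted convention: `carrier d` is the
degree `d` part of the shifted space `A[1]`, and all degrees below are shifted degrees.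
`m [x₁, …, x_n] q` is the component in degree `q` of `m_n (x₁, …, x_n)`. -/
structure AInfAlgebra (K : Type u) [Field K] where
  /-- the graded pieces of `A[1]` -/
  carrier : ℤ → Type v
  [addCommGroup : ∀ d, AddCommGroup (carrier d)]
  [module : ∀ d, Module K (carrier d)]
  /-- the operations -/
  m : List (Homog carrier) → ∀ q : ℤ, carrier q
  multilinear : ∀ (x z : List (Homog carrier)) (d : ℤ) (c : K) (a a' : carrier d) (q : ℤ),
    m (x ++ ⟨d, c • a + a'⟩ :: z) q = c • m (x ++ ⟨d, a⟩ :: z) q + m (x ++ ⟨d, a'⟩ :: z) q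
  degree_one : ∀ (x : List (Homog carrier)) (q : ℤ), q ≠ wdeg x + 1 → m x q = 0
  strict : ∀ q, m [] q = 0
  relation : ∀ (x : List (Homog carrier)) (q : ℤ), barSubst m x (fun x' => m x' q) = 0

attribute [instance] AInfAlgebra.addCommGroup AInfAlgebra.module

section Families

variable {K : Type u} [Field K] (A : AInfAlgebra.{u, v} K)

/-- A word of homogeneous elements of `A[1]`. -/
abbrev AInfAlgebra.Word : Type v := List (Homog A.carrier)

/-- A family of maps `f_{k,l} : A[1]^{⊗ k} ⊗ M ⊗ A[1]^{⊗ l} → P`. For words `x = (a₁, …, a_k)` and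
`y = (b₁, …, b_l)`, the map `f x y p q` sends `v` of degree `p` to the component in degree `q` of
`f_{k,l} (a₁, …, a_k, v, b₁, …, b_l)`. -/
abbrev Fam (M : ℤ → Type w) (P : ℤ → Type w') [∀ p, AddCommGroup (M p)] [∀ p, Module K (M p)]
    [∀ p, AddCommGroup (P p)] [∀ p, Module K (P p)] : Type _ :=
  A.Word → A.Word → ∀ p q : ℤ, M p →ₗ[K] P q

variable {A}

section

variable {M : ℤ → Type w} {P : ℤ → Type w'} [∀ p, AddCommGroup (M p)] [∀ p, Module K (M p)]
  [∀ p, AddCommGroup (P p)] [∀ p, Module K (P p)]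

/-- Linearity of a family in each of its arguments from `A[1]`. -/
structure Fam.IsMultilinear (f : Fam A M P) : Prop where
  left : ∀ (x z y : A.Word) (d : ℤ) (c : K) (a a' : A.carrier d) (p q : ℤ),
    f (x ++ ⟨d, c • a + a'⟩ :: z) y p q =
      c • f (x ++ ⟨d, a⟩ :: z) y p q + f (x ++ ⟨d, a'⟩ :: z) y p q
  right : ∀ (x y z : A.Word) (d : ℤ) (c : K) (a a' : A.carrier d) (p q : ℤ),
    f x (y ++ ⟨d, c • a + a'⟩ :: z) p q =
      c • f x (y ++ ⟨d, a⟩ :: z) p q + f x (y ++ ⟨d, a'⟩ :: z) p q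

/-- The family is homogeneous of degree `e`. -/
def Fam.HasDegree (f : Fam A M P) (e : ℤ) : Prop :=
  ∀ (x y : A.Word) (p q : ℤ), q ≠ wdeg x + p + wdeg y + e → f x y p q = 0

/-- The composite `f ∘ b̂`, where `b̂` is the map on `BA ⊗ M ⊗ BA` induced by the operations of `A`
and a family `b` of degree one on `M`: on `x ⊗ v ⊗ y` it is the sum of
`(-1)^|x₁| f (x₁, m x₂, x₃, v, y)`, of `(-1)^|x₁| f (x₁, b (x₂, v, y₁), y₂)` and of
`(-1)^(|x| + |v| + |y₁|) f (x, v, y₁, m y₂, y₃)`. -/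
def Fam.compHat (f : Fam A M P) (b : Fam A M M) : Fam A M P := fun x y p q =>
  barSubst A.m x (fun x' => f x' y p q) +
  ∑ i ∈ Finset.range (x.length + 1), ∑ j ∈ Finset.range (y.length + 1),
    (wdeg (x.take i)).negOnePow •
      (f (x.take i) (y.drop j) (wdeg (x.drop i) + p + wdeg (y.take j) + 1) q ∘ₗ
        b (x.drop i) (y.take j) p (wdeg (x.drop i) + p + wdeg (y.take j) + 1)) +
  (wdeg x + p).negOnePow • barSubst A.m y (fun y' => f x y' p q)

end

/-- The composite `g ∘ f̂`, where `f̂` is the map `BA ⊗ M ⊗ BA → BA ⊗ P ⊗ BA` induced by a family `f`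
of degree zero: `(x, v, y) ↦ ∑ g (x₁, f (x₂, v, y₁), y₂)`, over all `x = x₁ x₂` and `y = y₁ y₂`. -/
def Fam.comp {M P Q : ℤ → Type*} [∀ p, AddCommGroup (M p)] [∀ p, Module K (M p)]
    [∀ p, AddCommGroup (P p)] [∀ p, Module K (P p)] [∀ p, AddCommGroup (Q p)]
    [∀ p, Module K (Q p)] (g : Fam A P Q) (f : Fam A M P) : Fam A M Q := fun x y p q =>
  ∑ i ∈ Finset.range (x.length + 1), ∑ j ∈ Finset.range (y.length + 1),
    g (x.take i) (y.drop j) (wdeg (x.drop i) + p + wdeg (y.take j)) q ∘ₗ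
      f (x.drop i) (y.take j) p (wdeg (x.drop i) + p + wdeg (y.take j))

end Families

/-- An `A_∞`-bimodule over the `A_∞`-algebra `A`: a graded space with a family of operations
`b_{k,l} : A[1]^{⊗ k} ⊗ M ⊗ A[1]^{⊗ l} → M` of degree one such that `b ∘ b̂ = 0`. -/
structure AInfBimodule {K : Type u} [Field K] (A : AInfAlgebra.{u, v} K) where
  /-- the graded pieces -/
  carrier : ℤ → Type w
  [addCommGroup : ∀ p, AddCommGroup (carrier p)]
  [module : ∀ p, Module K (carrier p)]
  /-- the operations -/
  b : Fam A carrier carrier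
  multilinear : b.IsMultilinear
  degree_one : b.HasDegree 1
  relation : b.compHat b = 0

attribute [instance] AInfBimodule.addCommGroup AInfBimodule.module

section HelperFacts

variable {K : Type u} [Field K] {A : AInfAlgebra.{u, v} K}

theorem wdeg_append {V : ℤ → Type v} (x y : List (Homog V)) :
    wdeg (x ++ y) = wdeg x + wdeg y := by
  simp [wdeg]

theorem wdeg_cons {V : ℤ → Type v} (a : Homog V) (y : List (Homog V)) :
    wdeg (a :: y) = a.1 + wdeg y := by
  simp [wdeg]

theorem wdeg_take_drop {V : ℤ → Type v} (x : List (Homog V)) (i : ℕ) :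
    wdeg (x.take i) + wdeg (x.drop i) = wdeg x := by
  rw [← wdeg_append, List.take_append_drop]

theorem barSubst_congr {V : ℤ → Type v} (m : List (Homog V) → ∀ q : ℤ, V q) {M : Type*}
    [AddCommGroup M] (x : List (Homog V)) (F G : List (Homog V) → M)
    (h : ∀ x', wdeg x' = wdeg x + 1 → F x' = G x') : barSubst m x F = barSubst m x G := by
  unfold barSubst
  refine Finset.sum_congr rfl fun i _ => Finset.sum_congr rfl fun r _ => ?_
  rw [h]
  have h1 := wdeg_take_drop x i
  have h2 := wdeg_take_drop (x.drop i) r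
  rw [wdeg_append, wdeg_cons]
  dsimp only
  lia

theorem barSubst_map {V : ℤ → Type v} (m : List (Homog V) → ∀ q : ℤ, V q) {M N : Type*}
    [AddCommGroup M] [AddCommGroup N] (x : List (Homog V)) (F : List (Homog V) → M)
    (L : M →+ N) : L (barSubst m x F) = barSubst m x (fun x' => L (F x')) := by
  unfold barSubst
  simp only [map_sum, Units.smul_def, map_zsmul]

end HelperFacts

namespace AInfBimodule

variable {K : Type u} [Field K] {A : AInfAlgebra.{u, v} K}

/-- The graded dual of `C`, shifted so that a functional `f` has degree `p` if it is supported on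
elements `w` with `p + |w| + N = 0`. A map `C → C^*` of degree zero is thus a pairing of
degree `N` on `C`. -/
abbrev DualCarrier (C : AInfBimodule.{u, v, w} A) (N p : ℤ) : Type (max u w) :=
  Module.Dual K (C.carrier (-N - p))

/-- The operations of the dual bimodule:
`b^*(x, f, y)(w) = (-1)^(1 + |f| + |x| (|f| + |y| + |w|)) f (b (y, w, x))`. -/
def dualOp (C : AInfBimodule.{u, v, w} A) (N : ℤ) : Fam A (C.DualCarrier N) (C.DualCarrier N) :=
  fun x y p q =>
    (1 + p + wdeg x * (p + wdeg y + (-N - q))).negOnePow • (C.b y x (-N - q) (-N - p)).dualMap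

theorem dualOp_apply (C : AInfBimodule.{u, v, w} A) (N : ℤ) (x y : A.Word) (p q : ℤ)
    (f : C.DualCarrier N p) (w : C.carrier (-N - q)) :
    C.dualOp N x y p q f w = (1 + p + wdeg x * (p + wdeg y + (-N - q))).negOnePow •
      f (C.b y x (-N - q) (-N - p) w) := by
  simp [dualOp, Units.smul_def]

theorem compHat_apply_eq_zero (C : AInfBimodule.{u, v, w} A) (x y : A.Word) (p q : ℤ)
    (v : C.carrier p) : C.b.compHat C.b x y p q v = 0 := by
  rw [C.relation]; rfl

theorem dualOp_multilinear (C : AInfBimodule.{u, v, w} A) (N : ℤ) :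
    (C.dualOp N).IsMultilinear := by
  constructor
  · intro x z y d c a a' p q
    ext f w
    simp only [dualOp_apply, LinearMap.add_apply, LinearMap.smul_apply, C.multilinear.right,
      map_add, map_smul, smul_add, wdeg_append, wdeg_cons]
    rw [smul_comm]
  · intro x y z d c a a' p q
    ext f w
    simp only [dualOp_apply, LinearMap.add_apply, LinearMap.smul_apply, C.multilinear.left,
      map_add, map_smul, smul_add, wdeg_append, wdeg_cons]
    rw [smul_comm]

theorem dualOp_degree_one (C : AInfBimodule.{u, v, w} A) (N : ℤ) :
    (C.dualOp N).HasDegree 1 := by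
  intro x y p q h
  ext f w
  rw [dualOp_apply, C.degree_one y x (-N - q) (-N - p) (by lia)]
  simp

theorem negOnePow_congr {m n : ℤ} (h : (m : ZMod 2) = n) : m.negOnePow = n.negOnePow := by
  rw [Int.negOnePow_eq_iff, ← ZMod.intCast_eq_zero_iff_even]
  push_cast
  rw [h, sub_self]

theorem barSubst_apply {M P : Type*} [AddCommGroup M] [Module K M] [AddCommGroup P] [Module K P]
    (x : A.Word) (F : A.Word → M →ₗ[K] P) (v : M) :
    barSubst A.m x F v = barSubst A.m x (fun x' => F x' v) := by
  simp [barSubst, Units.smul_def]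

theorem compHat_apply {M : ℤ → Type w} {P : ℤ → Type w'} [∀ p, AddCommGroup (M p)]
    [∀ p, Module K (M p)] [∀ p, AddCommGroup (P p)] [∀ p, Module K (P p)]
    (f : Fam A M P) (b : Fam A M M) (x y : A.Word) (p q : ℤ) (v : M p) :
    f.compHat b x y p q v = barSubst A.m x (fun x' => f x' y p q v) +
      ∑ i ∈ Finset.range (x.length + 1), ∑ j ∈ Finset.range (y.length + 1),
        (wdeg (x.take i)).negOnePow •
          f (x.take i) (y.drop j) (wdeg (x.drop i) + p + wdeg (y.take j) + 1) q
            (b (x.drop i) (y.take j) p (wdeg (x.drop i) + p + wdeg (y.take j) + 1) v) +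
      (wdeg x + p).negOnePow • barSubst A.m y (fun y' => f x y' p q v) := by
  simp [Fam.compHat, barSubst_apply, Units.smul_def]

theorem compHat_degree {M : ℤ → Type w} {P : ℤ → Type w'} [∀ p, AddCommGroup (M p)]
    [∀ p, Module K (M p)] [∀ p, AddCommGroup (P p)] [∀ p, Module K (P p)]
    (f : Fam A M P) (b : Fam A M M) (e : ℤ) (hf : f.HasDegree e) :
    (f.compHat b).HasDegree (e + 1) := by
  intro x y p q hq
  have hx : barSubst A.m x (fun x' => f x' y p q) = barSubst A.m x (fun _ => 0) :=
    barSubst_congr _ _ _ _ fun x' h => hf _ _ _ _ (by lia)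
  have hy : barSubst A.m y (fun y' => f x y' p q) = barSubst A.m y (fun _ => 0) :=
    barSubst_congr _ _ _ _ fun x' h => hf _ _ _ _ (by lia)
  have hz : ∀ i j : ℕ,
      f (x.take i) (y.drop j) (wdeg (x.drop i) + p + wdeg (y.take j) + 1) q = 0 := by
    intro i j
    have h1 := wdeg_take_drop x i
    have h2 := wdeg_take_drop y j
    exact hf _ _ _ _ (by lia)
  simp only [Fam.compHat, hx, hy, hz]
  simp [barSubst]

theorem dualOp_relation (C : AInfBimodule.{u, v, w} A) (N : ℤ) :
    (C.dualOp N).compHat (C.dualOp N) = 0 := by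
  funext x y p q
  by_cases hq : q = wdeg x + p + wdeg y + 2
  · ext f w
    have key : f (C.b.compHat C.b y x (-N - q) (-N - p) w) = 0 := by
      rw [compHat_apply_eq_zero, map_zero]
    have hl : ∀ (z : A.Word) (G : A.Word → C.carrier (-N - p)),
        f (barSubst A.m z G) = barSubst A.m z (fun z' => f (G z')) := fun z G =>
      barSubst_map A.m z G f.toAddMonoidHom
    have hs : ∀ (n : ℤ) (c : C.carrier (-N - p)), f (n.negOnePow • c) = n.negOnePow • f c := by
      intro n c; simp [Units.smul_def]
    have hsub : ∀ (z : A.Word) (n : ℤ) (G : A.Word → K),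
        barSubst A.m z (fun z' => n.negOnePow • G z') = n.negOnePow • barSubst A.m z G := by
      intro z n G
      simp only [barSubst, Finset.smul_sum]
      refine Finset.sum_congr rfl fun i _ => Finset.sum_congr rfl fun r _ => smul_comm _ _ _
    have hmid : ∀ (x₁ x₂ y₁ y₂ : A.Word) (s s' : ℤ), s = s' →
        C.b y₁ x₂ s (-N - p) (C.b y₂ x₁ (-N - q) s w) =
        C.b y₁ x₂ s' (-N - p) (C.b y₂ x₁ (-N - q) s' w) := by
      rintro x₁ x₂ y₁ y₂ s _ rfl; rfl
    rw [compHat_apply] at key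
    rw [compHat_apply]
    simp only [map_add, map_sum, hl, hs] at key
    simp only [LinearMap.add_apply, LinearMap.sum_apply]
    have e1 : barSubst A.m x (fun x' => C.dualOp N x' y p q f) w =
        (1 + p + (wdeg x + 1) * (p + wdeg y + (-N - q))).negOnePow •
          barSubst A.m x (fun x' => f (C.b y x' (-N - q) (-N - p) w)) := by
      rw [← hsub]
      rw [barSubst_apply]
      refine barSubst_congr _ _ _ _ fun x' h => ?_
      simp [dualOp_apply, h]
    have e2 : barSubst A.m y (fun y' => C.dualOp N x y' p q f) w =
        (1 + p + wdeg x * (p + (wdeg y + 1) + (-N - q))).negOnePow •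
          barSubst A.m y (fun y' => f (C.b y' x (-N - q) (-N - p) w)) := by
      rw [← hsub]
      rw [barSubst_apply]
      refine barSubst_congr _ _ _ _ fun x' h => ?_
      simp [dualOp_apply, h]
    have e3 : ∀ i j : ℕ, ((wdeg (x.take i)).negOnePow •
          C.dualOp N (x.take i) (y.drop j) (wdeg (x.drop i) + p + wdeg (y.take j) + 1) q
            (C.dualOp N (x.drop i) (y.take j) p
              (wdeg (x.drop i) + p + wdeg (y.take j) + 1) f)) w =
        (1 + wdeg x * (p + wdeg y + (-N - q))).negOnePow • (wdeg (y.take j)).negOnePow •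
          f (C.b (y.take j) (x.drop i) (wdeg (y.drop j) + (-N - q) + wdeg (x.take i) + 1) (-N - p)
            (C.b (y.drop j) (x.take i) (-N - q)
              (wdeg (y.drop j) + (-N - q) + wdeg (x.take i) + 1) w)) := by
      intro i j
      have h1 := wdeg_take_drop x i
      have h2 := wdeg_take_drop y j
      rw [hmid _ _ _ _ _ (-N - (wdeg (x.drop i) + p + wdeg (y.take j) + 1)) (by lia)]
      have : ∀ (n : ℤ) (F : C.DualCarrier N q), (n.negOnePow • F) w = n.negOnePow • F w := by
        intro n F; simp [Units.smul_def]
      rw [this, dualOp_apply, dualOp_apply]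
      simp only [smul_smul, ← Int.negOnePow_add]
      congr 1
      have hq' : (q : ZMod 2) = wdeg (x.take i) + wdeg (x.drop i) + p +
          (wdeg (y.take j) + wdeg (y.drop j)) + 2 := by
        rw [hq, ← h1, ← h2]; push_cast; ring
      rw [← h1, ← h2]
      apply negOnePow_congr
      push_cast
      rw [hq']
      generalize (wdeg (x.take i) : ZMod 2) = a
      generalize (wdeg (x.drop i) : ZMod 2) = a'
      generalize (wdeg (y.take j) : ZMod 2) = c
      generalize (wdeg (y.drop j) : ZMod 2) = c'
      generalize (N : ZMod 2) = n
      generalize (p : ZMod 2) = o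
      revert a a' c c' n o
      decide
    have hu : ∀ (n : ℤ) (F : C.DualCarrier N q), (n.negOnePow • F) w = n.negOnePow • F w := by
      intro n F; simp [Units.smul_def]
    rw [hu, e1, e2]
    simp only [e3]
    rw [Finset.sum_comm] at key
    simp only [← Finset.smul_sum]
    have key2 := congrArg (fun t => (1 + wdeg x * (p + wdeg y + (-N - q))).negOnePow • t) key
    simp only [smul_add, smul_smul, smul_zero, ← Int.negOnePow_add] at key2
    simp only [smul_smul, ← Int.negOnePow_add]
    have s1 : (1 + p + (wdeg x + 1) * (p + wdeg y + (-N - q))).negOnePow =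
        (1 + wdeg x * (p + wdeg y + (-N - q)) + (wdeg y + (-N - q))).negOnePow := by
      apply negOnePow_congr
      push_cast
      generalize (wdeg x : ZMod 2) = a
      generalize (wdeg y : ZMod 2) = c
      generalize (N : ZMod 2) = n
      generalize (q : ZMod 2) = e
      generalize (p : ZMod 2) = o
      revert a c n e o
      decide
    have s2 : (wdeg x + p + (1 + p + wdeg x * (p + (wdeg y + 1) + (-N - q)))).negOnePow =
        (1 + wdeg x * (p + wdeg y + (-N - q))).negOnePow := by
      apply negOnePow_congr
      push_cast
      generalize (wdeg x : ZMod 2) = a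
      generalize (wdeg y : ZMod 2) = c
      generalize (N : ZMod 2) = n
      generalize (q : ZMod 2) = e
      generalize (p : ZMod 2) = o
      revert a c n e o
      decide
    rw [s1, s2]
    refine Eq.trans ?_ key2
    abel
  · have := compHat_degree (C.dualOp N) (C.dualOp N) 1 (C.dualOp_degree_one N) x y p q (by lia)
    rw [this]; rfl

/-- The dual bimodule `C^*` of `C`, shifted so that maps `C → C^*` of degree zero are pairings
of degree `N` on `C`. -/
abbrev dual (C : AInfBimodule.{u, v, w} A) (N : ℤ) : AInfBimodule.{u, v, max u w} A where
  carrier := C.DualCarrier N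
  b := C.dualOp N
  multilinear := C.dualOp_multilinear N
  degree_one := C.dualOp_degree_one N
  relation := C.dualOp_relation N

/-- The space of degree `p` cycles of the differential `b_{0,0}`. -/
def cycles (C : AInfBimodule.{u, v, w} A) (p : ℤ) : Submodule K (C.carrier p) :=
  LinearMap.ker (C.b [] [] p (p + 1))

/-- The space of degree `p` boundaries, seen inside the cycles. -/
def boundaries (C : AInfBimodule.{u, v, w} A) (p : ℤ) : Submodule K (C.cycles p) :=
  (LinearMap.range (C.b [] [] (p - 1) p)).comap (C.cycles p).subtype

/-- The degree `p` cohomology of `C` with respect to `b_{0,0}`. -/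
abbrev Cohomology (C : AInfBimodule.{u, v, w} A) (p : ℤ) : Type w :=
  C.cycles p ⧸ C.boundaries p

/-- An `A_∞`-bimodule map `C → D`: a family `f_{k,l} : A[1]^{⊗ k} ⊗ C ⊗ A[1]^{⊗ l} → D` of
degree zero with `f ∘ b̂ = b ∘ f̂`. -/
structure Hom (C : AInfBimodule.{u, v, w} A) (D : AInfBimodule.{u, v, w'} A) where
  /-- the underlying family of maps -/
  f : Fam A C.carrier D.carrier
  multilinear : f.IsMultilinear
  degree_zero : f.HasDegree 0
  commutes : f.compHat C.b = D.b.comp f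

namespace Hom

variable {C : AInfBimodule.{u, v, w} A} {D : AInfBimodule.{u, v, w'} A}

theorem comm_differential (g : Hom C D) (p q : ℤ) (hq : q = p + 1) (v : C.carrier p) :
    g.f [] [] q q (C.b [] [] p q v) = D.b [] [] p q (g.f [] [] p p v) := by
  subst hq
  have h := congrArg (fun F : Fam A C.carrier D.carrier => F [] [] p (p + 1) v) g.commutes
  have e : ∀ s, s = p → D.b [] [] s (p + 1) (g.f [] [] p s v) =
      D.b [] [] p (p + 1) (g.f [] [] p p v) := by
    rintro s rfl; rfl
  have e' : ∀ s, s = p + 1 → g.f [] [] s (p + 1) (C.b [] [] p s v) =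
      g.f [] [] (p + 1) (p + 1) (C.b [] [] p (p + 1) v) := by
    rintro s rfl; rfl
  rw [← e (0 + p + 0) (by lia), ← e' (0 + p + 0 + 1) (by lia)]
  simp only [Fam.compHat, Fam.comp, barSubst, wdeg, List.length_nil, zero_add,
    Finset.range_one, Finset.sum_singleton, List.take_nil, Nat.sub_zero, zero_lt_one,
    Finset.Icc_eq_empty_of_lt, Finset.sum_empty, smul_zero, add_zero, List.map_nil, List.sum_nil,
    Int.negOnePow_zero, one_smul] at h
  exact h

/-- The map induced by `g_{0,0}` on cycles. -/
def cyclesMap (g : Hom C D) (p : ℤ) : C.cycles p →ₗ[K] D.cycles p :=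
  (g.f [] [] p p).restrict fun v hv => by
    have hv' : C.b [] [] p (p + 1) v = 0 := hv
    change D.b [] [] p (p + 1) (g.f [] [] p p v) = 0
    rw [← g.comm_differential p (p + 1) rfl, hv', map_zero]

/-- The map induced by `g_{0,0}` on cohomology. -/
def cohomologyMap (g : Hom C D) (p : ℤ) : C.Cohomology p →ₗ[K] D.Cohomology p :=
  Submodule.mapQ _ _ (g.cyclesMap p) <| by
    rintro ⟨v, hv⟩ ⟨u, hu⟩
    refine ⟨g.f [] [] (p - 1) (p - 1) u, ?_⟩
    rw [← g.comm_differential (p - 1) p (by lia)]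
    exact congrArg _ hu

/-- `g` is a quasi-isomorphism: `g_{0,0}` induces an isomorphism on cohomology. -/
def IsQuasiIso (g : Hom C D) : Prop := ∀ p, Function.Bijective (g.cohomologyMap p)

/-- The dual `g^* : D^* → C^*` of `g : C → D`:
`g^*(x, f, y)(w) = (-1)^(|x| (|f| + |y| + |w|)) f (g (y, w, x))`. -/
def dualMap (g : Hom C D) (N : ℤ) : Fam A (D.dual N).carrier (C.dual N).carrier := fun x y p q =>
  (wdeg x * (p + wdeg y + (-N - q))).negOnePow • (g.f y x (-N - q) (-N - p)).dualMap

/-- The scalar `φ(x, v, y)(w)`, for a map `φ : C → C^*` and `v` of degree `p`; the functional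
`φ(x, v, y)` is taken in degree `q`, so that it is evaluated on `w` of degree `-N - q`. -/
def form {N : ℤ} (φ : Hom C (C.dual N)) (x y : A.Word) (p q : ℤ) (v : C.carrier p)
    (w : C.carrier (-N - q)) : K :=
  (show Module.Dual K (C.carrier (-N - q)) from φ.f x y p q v) w

/-- Skew symmetry of `φ : C → C^*`: for `v` and `w` homogeneous,
`φ(x, v, y)(w) = -(-1)^((|x| + |v|) (|y| + |w|)) φ(y, w, x)(v)`.
The degrees of `v` and `w` are written `-N - p` and `-N - q`, so that `v` and `w` can be inserted
into functionals of degree `p` and `q` respectively. -/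
def IsSkew {N : ℤ} (φ : Hom C (C.dual N)) : Prop :=
  ∀ (x y : A.Word) (p q : ℤ) (v : C.carrier (-N - p)) (w : C.carrier (-N - q)),
    φ.form x y (-N - p) q v w =
      -(((wdeg x + (-N - p)) * (wdeg y + (-N - q))).negOnePow • φ.form y x (-N - q) p w v)

/-- Homological non-degeneracy of `φ : C → C^*`: for every cycle `a` with non-zero class there is
a cycle `b` with `φ_{0,0}(a)(b) ≠ 0`. -/
def IsHomologicallyNondegenerate {N : ℤ} (φ : Hom C (C.dual N)) : Prop :=
  ∀ (p : ℤ) (a : C.cycles p), (Submodule.Quotient.mk a : C.Cohomology p) ≠ 0 →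
    ∃ b : C.cycles (-N - p), φ.form [] [] p p a b ≠ 0

/-- `ψ : D → D^*` is a cyclic symmetric inner product: only `ψ_{0,0}` is non-zero, and it is skew
symmetric and non-degenerate, i.e. an isomorphism onto the graded dual. -/
structure IsCyclicInnerProduct {N : ℤ} (ψ : Hom C (C.dual N)) : Prop where
  higher_eq_zero : ∀ (x y : A.Word), (x, y) ≠ ([], []) → ∀ p q, ψ.f x y p q = 0
  skew : ∀ (p q : ℤ) (v : C.carrier (-N - p)) (w : C.carrier (-N - q)),
    ψ.form [] [] (-N - p) q v w =
      -(((-N - p) * (-N - q)).negOnePow • ψ.form [] [] (-N - q) p w v)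
  nondegenerate : ∀ p, Function.Bijective (ψ.f [] [] p p)

/-- `φ : C → C^*` is a homotopy inner product (of degree `N`): there are a bimodule `D` with a
cyclic symmetric inner product `ψ : D → D^*` and a quasi-isomorphism of bimodules `g : C → D` with
`φ = g^* ∘ ψ ∘ g`. -/
def IsHomotopyInnerProduct {N : ℤ} (φ : Hom C (C.dual N)) : Prop :=
  ∃ (D : AInfBimodule.{u, v, w} A) (ψ : Hom D (D.dual N)) (g : Hom C D),
    ψ.IsCyclicInnerProduct ∧ g.IsQuasiIso ∧ φ.f = (g.dualMap N).comp (ψ.f.comp g.f)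

end Hom

end AInfBimodule

/-! Families of maps `A[1]^{⊗ k} ⊗ M ⊗ A[1]^{⊗ l} → P` compose by `cmp`, and substituting the
operations of `A` into the words gives `bar`, a derivation of odd degree that squares to zero on
multilinear families. In this calculus a bimodule is a solution of `bar b + b b = 0`, and a bimodule
map is a solution of `bar f + f b = b' f`. Everything is filtered by the number of letters from `A`.
An equation whose right side involves the unknown only on shorter words has a solution
(`exists_fixed`), and a family that vanishes whenever it vanishes on shorter words is zero
(`eq_zero_of_agreeBelow`).

If `φ = g^* ψ g`, then `φ` is skew because skew symmetry survives pullback (`SkewPair.pullback`). A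
cycle of `C` that pairs to zero with all cycles is sent by `g` to a cycle of `D` with the same
property, since `g` is onto in cohomology; non-degeneracy of `ψ` makes that image a boundary, and
`g` is injective in cohomology.

Conversely, contract `C` onto `H = H^*(C)` (`exists_splitting`), and let `ι`, `ρ`, `η` be the
inclusion, the projection and the homotopy, and `d` the differential. The perturbed inclusion `i = ι
- η (b - d) i` pulls `φ` back to a skew pairing `X = i^* φ i` on `H`. Its constant part is
invertible, by homological non-degeneracy and finite dimensionality. As in Darboux normal form,
there is a change of variables `t = 1 + τ` with `t^* X t = X_{0,0}` (`exists_normalization`); a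
square root is in effect extracted, which needs `1/2`. Only then is `H` given a bimodule structure:
homotopy transfer along `j = i t` (`exists_transfer`) yields `D = (H, β)` and a map `J : D → C`.

Now `Ψ = J^* φ J` is the constant pairing `X_{0,0}`, so it is a cyclic inner product, and its
inverse is again a bimodule map. Then `g = Ψ⁻¹ J^* φ : C → D` is a quasi-isomorphism, and `g^* Ψ g`
is a homotopy inner product. It need not equal `φ`; only existence is claimed. -/

/-! ### Sums over the factorisations of a word -/

section SplitSum

variable {α : Type*} {M N : Type*} [AddCommGroup M] [AddCommGroup N]

/-- The sum of `F x₁ x₂` over all factorisations `x = x₁ x₂`. -/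
def splitSum (x : List α) (F : List α → List α → M) : M :=
  ∑ i ∈ Finset.range (x.length + 1), F (x.take i) (x.drop i)

@[simp]
theorem splitSum_nil (F : List α → List α → M) : splitSum [] F = F [] [] := by
  simp [splitSum]

@[simp]
theorem splitSum_cons (a : α) (x : List α) (F : List α → List α → M) :
    splitSum (a :: x) F = F [] (a :: x) + splitSum x (fun x₁ x₂ => F (a :: x₁) x₂) := by
  rw [splitSum, List.length_cons, Finset.sum_range_succ', add_comm]
  simp [splitSum]

theorem splitSum_congr {x : List α} {F G : List α → List α → M}
    (h : ∀ x₁ x₂, x₁ ++ x₂ = x → F x₁ x₂ = G x₁ x₂) : splitSum x F = splitSum x G :=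
  Finset.sum_congr rfl fun i _ => h _ _ (List.take_append_drop i x)

theorem splitSum_add (x : List α) (F G : List α → List α → M) :
    splitSum x (fun x₁ x₂ => F x₁ x₂ + G x₁ x₂) = splitSum x F + splitSum x G :=
  Finset.sum_add_distrib

theorem splitSum_map (x : List α) (F : List α → List α → M) {L : Type*} [FunLike L M N]
    [AddMonoidHomClass L M N] (l : L) :
    l (splitSum x F) = splitSum x (fun x₁ x₂ => l (F x₁ x₂)) :=
  map_sum _ _ _

theorem splitSum_smul (x : List α) (F : List α → List α → M) {R : Type*} [Monoid R]
    [DistribMulAction R M] (c : R) :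
    splitSum x (fun x₁ x₂ => c • F x₁ x₂) = c • splitSum x F :=
  Finset.smul_sum.symm

theorem splitSum_zero (x : List α) : splitSum x (fun _ _ => (0 : M)) = 0 :=
  Finset.sum_const_zero

theorem splitSum_comm {β : Type*} (x : List α) (y : List β)
    (F : List α → List α → List β → List β → M) :
    splitSum x (fun x₁ x₂ => splitSum y (F x₁ x₂)) =
      splitSum y (fun y₁ y₂ => splitSum x (fun x₁ x₂ => F x₁ x₂ y₁ y₂)) :=
  Finset.sum_comm

/-- Coassociativity of deconcatenation: both sides run over factorisations into three words. -/
theorem splitSum_assoc (x : List α) (F : List α → List α → List α → M) :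
    splitSum x (fun x₁ r => splitSum r (fun x₂ x₃ => F x₁ x₂ x₃)) =
      splitSum x (fun l x₃ => splitSum l (fun x₁ x₂ => F x₁ x₂ x₃)) := by
  induction x generalizing F with
  | nil => simp
  | cons a x ih =>
    simp only [splitSum_cons, ih, splitSum_nil, splitSum_add, add_assoc]

theorem splitSum_left_nil (x : List α) (F : List α → List α → M)
    (h : ∀ x₁ x₂, x₁ ≠ [] → F x₁ x₂ = 0) : splitSum x F = F [] x := by
  cases x with
  | nil => simp
  | cons a x =>
    rw [splitSum_cons, splitSum_congr (G := fun _ _ => 0) fun _ _ _ => h _ _ (by simp),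
      splitSum_zero, add_zero]

theorem splitSum_right_nil (x : List α) (F : List α → List α → M)
    (h : ∀ x₁ x₂, x₂ ≠ [] → F x₁ x₂ = 0) : splitSum x F = F x [] := by
  induction x generalizing F with
  | nil => simp
  | cons a x ih =>
    rw [splitSum_cons, h _ _ (by simp), zero_add, ih _ fun _ _ => h _ _]

/-- Linearity of a sum over factorisations in one letter of the word. -/
theorem splitSum_linear {K : Type*} [Semiring K] [Module K M] (c : K) (a₁ a₂ a₃ : α)
    (x z : List α) (F : List α → List α → M)
    (hl : ∀ u u' t, F (u ++ a₁ :: u') t = c • F (u ++ a₂ :: u') t + F (u ++ a₃ :: u') t)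
    (hr : ∀ t u u', F t (u ++ a₁ :: u') = c • F t (u ++ a₂ :: u') + F t (u ++ a₃ :: u')) :
    splitSum (x ++ a₁ :: z) F = c • splitSum (x ++ a₂ :: z) F + splitSum (x ++ a₃ :: z) F := by
  induction x generalizing F with
  | nil =>
    have h := hr [] [] z
    simp only [List.nil_append] at h
    simp only [List.nil_append, splitSum_cons, h, smul_add, ← splitSum_smul]
    have h' := splitSum_congr (x := z) fun x₁ x₂ _ => hl [] x₁ x₂
    simp only [List.nil_append, splitSum_add] at h'
    rw [h']
    abel
  | cons b x ih =>
    have h := hr [] (b :: x) z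
    simp only [List.cons_append] at h
    simp only [List.cons_append, splitSum_cons, h, smul_add]
    rw [ih]
    · abel
    · intro u u' t
      exact hl (b :: u) u' t
    · intro t u u'
      exact hr (b :: t) u u'

end SplitSum

/-! ### The coderivation of the bar construction -/

section BarSubst

variable {V : ℤ → Type v} (m : List (Homog V) → ∀ q : ℤ, V q) {M N : Type*} [AddCommGroup M]
  [AddCommGroup N]

@[simp]
theorem wdeg_nil {V : ℤ → Type v} : wdeg ([] : List (Homog V)) = 0 := rfl

/-- The value of a family of operations of degree one on a word, with its degree. -/
def opLetter (x : List (Homog V)) : Homog V := ⟨wdeg x + 1, m x (wdeg x + 1)⟩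

@[simp]
theorem barSubst_nil (F : List (Homog V) → M) : barSubst m [] F = 0 := by
  simp [barSubst]

/-- The substituted block either starts at the first letter or leaves it untouched, at the cost of
its Koszul sign. This recursion on words drives the inductions below in place of the doubly indexed
sum. -/
theorem barSubst_cons (a : Homog V) (x : List (Homog V)) (F : List (Homog V) → M) :
    barSubst m (a :: x) F = splitSum x (fun x₁ x₂ => F (opLetter m (a :: x₁) :: x₂)) +
      a.1.negOnePow • barSubst m x (fun x' => F (a :: x')) := by
  unfold barSubst splitSum
  rw [List.length_cons, Finset.sum_range_succ', add_comm]
  congr 1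
  · refine (Finset.sum_nbij' (fun r => r + 1) (fun r => r - 1) ?_ ?_ ?_ ?_ ?_).symm
    · intro r hr
      simp at hr ⊢
      lia
    · intro r hr
      simp at hr ⊢
      lia
    · simp
    · intro r hr
      simp at hr ⊢
      lia
    · intro r _
      exact (one_smul ℤˣ _).symm
  · simp only [Finset.smul_sum, List.take_succ_cons, List.drop_succ_cons, wdeg_cons,
      Int.negOnePow_add, mul_smul, Nat.add_sub_add_right, List.cons_append]
    rfl

theorem barSubst_add (x : List (Homog V)) (F G : List (Homog V) → M) :
    barSubst m x (fun x' => F x' + G x') = barSubst m x F + barSubst m x G := by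
  simp only [barSubst, smul_add, Finset.sum_add_distrib]

theorem barSubst_smul {R : Type*} [Monoid R] [DistribMulAction R M] (c : R)
    [SMulCommClass ℤˣ R M] (x : List (Homog V)) (F : List (Homog V) → M) :
    barSubst m x (fun x' => c • F x') = c • barSubst m x F := by
  simp only [barSubst, Finset.smul_sum, smul_comm c]

theorem barSubst_zero (x : List (Homog V)) : barSubst m x (fun _ => (0 : M)) = 0 := by
  simp [barSubst]

theorem barSubst_splitSum_comm {β : Type*} (x : List (Homog V)) (y : List β)
    (F : List (Homog V) → List β → List β → M) :
    barSubst m x (fun x' => splitSum y (F x')) =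
      splitSum y (fun y₁ y₂ => barSubst m x (fun x' => F x' y₁ y₂)) := by
  induction x generalizing F with
  | nil => simp [splitSum_zero]
  | cons a x ih =>
    simp only [barSubst_cons, splitSum_add, splitSum_smul, ih]
    rw [splitSum_comm]

theorem barSubst_comm (x y : List (Homog V)) (F : List (Homog V) → List (Homog V) → M) :
    barSubst m x (fun x' => barSubst m y (F x')) =
      barSubst m y (fun y' => barSubst m x (fun x' => F x' y')) := by
  induction x generalizing F with
  | nil => simp [barSubst_zero]
  | cons a x ih =>
    simp only [barSubst_cons, barSubst_add, barSubst_smul, ih, barSubst_splitSum_comm]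

/-- Substitution into a word that is then factored. -/
theorem barSubst_splitSum (x : List (Homog V)) (F : List (Homog V) → List (Homog V) → M) :
    barSubst m x (fun x' => splitSum x' F) =
      splitSum x (fun x₁ x₂ => barSubst m x₁ (fun x' => F x' x₂)) +
      splitSum x (fun x₁ x₂ => (wdeg x₁).negOnePow • barSubst m x₂ (fun x' => F x₁ x')) := by
  induction x generalizing F with
  | nil => simp
  | cons a x ih =>
    simp only [barSubst_cons, splitSum_cons, ih, splitSum_add, barSubst_nil, wdeg_nil,
      Int.negOnePow_zero, one_smul, zero_add, smul_add, barSubst_add, ← splitSum_smul,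
      splitSum_assoc, wdeg_cons, Int.negOnePow_add, mul_smul]
    abel

end BarSubst

/-! ### The bar differential squares to zero -/

theorem sigma_congr_degree {V : ℤ → Type v} (f : ∀ q, V q) {p q : ℤ} (h : p = q) :
    (⟨p, f p⟩ : Homog V) = ⟨q, f q⟩ := by
  subst h; rfl

namespace AInfAlgebra

variable {K : Type u} [Field K] (A : AInfAlgebra.{u, v} K) {M : Type*} [AddCommGroup M] [Module K M]

/-- Multilinearity of a function of a word. -/
def WordLinear (F : A.Word → M) : Prop :=
  ∀ (x z : A.Word) (d : ℤ) (c : K) (a a' : A.carrier d),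
    F (x ++ ⟨d, c • a + a'⟩ :: z) = c • F (x ++ ⟨d, a⟩ :: z) + F (x ++ ⟨d, a'⟩ :: z)

variable {A}

theorem WordLinear.cons {F : A.Word → M} (h : A.WordLinear F) (a : Homog A.carrier) :
    A.WordLinear (fun x => F (a :: x)) := fun x z d c b b' => h (a :: x) z d c b b'

theorem wordLinear_opLetter {F : A.Word → M} (h : A.WordLinear F) (y : A.Word) :
    A.WordLinear (fun x => F (opLetter A.m x :: y)) := by
  intro x z d c a a'
  have hd : ∀ b : A.carrier d, wdeg (x ++ ⟨d, b⟩ :: z) = wdeg x + d + wdeg z := by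
    intro b; simp [wdeg_append, wdeg_cons, add_assoc]
  have e : ∀ b : A.carrier d, opLetter A.m (x ++ ⟨d, b⟩ :: z) =
      ⟨wdeg x + d + wdeg z + 1, A.m (x ++ ⟨d, b⟩ :: z) (wdeg x + d + wdeg z + 1)⟩ := fun b =>
    sigma_congr_degree (fun q => A.m (x ++ ⟨d, b⟩ :: z) q) (by rw [hd])
  simp only [e, A.multilinear]
  exact h [] y _ _ _ _

theorem wordLinear_barSubst {F : A.Word → M} (h : A.WordLinear F) :
    A.WordLinear (fun x => barSubst A.m x F) := by
  intro x z d c a a'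
  induction x generalizing F with
  | nil =>
    simp only [List.nil_append, barSubst_cons, smul_add, ← splitSum_smul]
    have h₁ := splitSum_congr (x := z) fun x₁ x₂ _ => wordLinear_opLetter h x₂ [] x₁ d c a a'
    have h₂ := fun x' => h [] x' d c a a'
    simp only [List.nil_append, splitSum_add] at h₁ h₂
    simp only [h₁, h₂, barSubst_add, smul_add, barSubst_smul, smul_comm c (Int.negOnePow _)]
    abel
  | cons b x ih =>
    have h₁ := ih (h.cons b)
    simp only [List.cons_append, barSubst_cons] at h₁ ⊢
    have h₂ := splitSum_linear c (⟨d, c • a + a'⟩ : Homog A.carrier) ⟨d, a⟩ ⟨d, a'⟩ x z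
      (fun x₁ x₂ => F (opLetter A.m (b :: x₁) :: x₂))
      (fun u u' t => wordLinear_opLetter h t (b :: u) u' d c a a')
      (fun t u u' => h (_ :: u) u' d c a a')
    rw [h₁, h₂]
    simp only [smul_add, smul_comm c (Int.negOnePow _)]
    abel

theorem WordLinear.zero_letter {F : A.Word → M} (h : A.WordLinear F) (x z : A.Word) (d : ℤ) :
    F (x ++ ⟨d, 0⟩ :: z) = 0 := by
  have := h x z d 1 0 0
  simpa using this

/-- The `A_∞` relation of `x`, read off in one letter. All the letters that occur have degree `|x| +
2`, and `F` is additive in a letter of fixed degree, so the sum can be moved inside `F`. -/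
theorem apply_barSubst_opLetter {F : A.Word → M} (h : A.WordLinear F) (x z : A.Word) :
    barSubst A.m x (fun x' => F (opLetter A.m x' :: z)) = 0 := by
  have key : ∀ (G : A.Word → Homog A.carrier) (g : A.Word → A.carrier (wdeg x + 2)),
    (∀ x', wdeg x' = wdeg x + 1 → G x' = ⟨wdeg x + 2, g x'⟩) →
    barSubst A.m x (fun x' => F (G x' :: z)) = F (⟨wdeg x + 2, barSubst A.m x g⟩ :: z) := by
    intro G g hG
    rw [barSubst_congr _ _ _ (fun x' => F (⟨wdeg x + 2, g x'⟩ :: z)) fun x' hx => by rw [hG x' hx]]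
    let L : A.carrier (wdeg x + 2) →+ M :=
      { toFun := fun a => F (⟨wdeg x + 2, a⟩ :: z)
        map_zero' := h.zero_letter [] z _
        map_add' := fun a b => by simpa using h [] z (wdeg x + 2) 1 a b }
    exact (barSubst_map A.m x g L).symm
  rw [key _ (fun x' => A.m x' (wdeg x + 2)), A.relation]
  · exact h.zero_letter [] z _
  · intro x' hx
    exact sigma_congr_degree (fun q => A.m x' q) (by lia)

/-- The coderivation of the bar construction induced by `m` squares to zero. -/
theorem barSubst_barSubst {F : A.Word → M} (h : A.WordLinear F) (x : A.Word) :
    barSubst A.m x (fun x' => barSubst A.m x' F) = 0 := by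
  induction x generalizing F with
  | nil => simp
  | cons a x ih =>
    -- Nested blocks of which the outer one starts at the first letter cancel by the relation.
    have key := splitSum_congr (x := x) fun x₁ x₂ _ => apply_barSubst_opLetter h (a :: x₁) x₂
    simp only [barSubst_cons, splitSum_zero, splitSum_add] at key
    simp only [barSubst_cons, splitSum_add, barSubst_add, ih (h.cons a), barSubst_smul,
      barSubst_splitSum, smul_zero, add_zero]
    -- The new letter has degree one more than the block it replaces, so two disjoint blocks
    -- contribute opposite signs when substituted in the two possible orders.
    have sign : ∀ (x₁ : A.Word) (c : M), ((opLetter A.m (a :: x₁)).1).negOnePow • c =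
        a.1.negOnePow • (wdeg x₁).negOnePow • (-c) := fun x₁ c => by
      rw [opLetter, wdeg_cons, Int.negOnePow_succ, Int.negOnePow_add, Units.neg_smul, mul_smul,
        smul_neg, smul_neg]
    have neg : ∀ (F : A.Word → A.Word → M), splitSum x (fun x₁ x₂ => -F x₁ x₂) = -splitSum x F :=
      fun F => Finset.sum_neg_distrib _
    simp only [sign, splitSum_smul, smul_neg, neg, smul_add] at key ⊢
    rw [splitSum_assoc, ← key]
    abel

end AInfAlgebra

/-! ### Composition of families and the Leibniz rule -/

namespace Fam

variable {K : Type u} [Field K] {A : AInfAlgebra.{u, v} K}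
variable {M P Q R : ℤ → Type*} [∀ p, AddCommGroup (M p)] [∀ p, Module K (M p)]
  [∀ p, AddCommGroup (P p)] [∀ p, Module K (P p)] [∀ p, AddCommGroup (Q p)]
  [∀ p, Module K (Q p)] [∀ p, AddCommGroup (R p)] [∀ p, Module K (R p)]

/-- The composite of two members of two families, through a specified intermediate degree. -/
def through (f : Fam A P Q) (g : Fam A M P) (x₁ y₂ x₂ y₁ : A.Word) (p s q : ℤ) : M p →ₗ[K] Q q :=
  f x₁ y₂ s q ∘ₗ g x₂ y₁ p s

theorem through_apply (f : Fam A P Q) (g : Fam A M P) (x₁ y₂ x₂ y₁ : A.Word) (p s q : ℤ) (v : M p) :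
    through f g x₁ y₂ x₂ y₁ p s q v = f x₁ y₂ s q (g x₂ y₁ p s v) := rfl

/-- The composite `f ∘ ĝ`, for a family `g` of degree `e`, with Koszul signs. -/
def cmp (e : ℤ) (f : Fam A P Q) (g : Fam A M P) : Fam A M Q := fun x y p q =>
  splitSum x fun x₁ x₂ => splitSum y fun y₁ y₂ =>
    (e * wdeg x₁).negOnePow • through f g x₁ y₂ x₂ y₁ p (wdeg x₂ + p + wdeg y₁ + e) q

/-- The composite of a family with the coderivation induced by the operations of `A` on the words
on both sides. -/
def bar (f : Fam A M P) : Fam A M P := fun x y p q =>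
  barSubst A.m x (fun x' => f x' y p q) +
    (wdeg x + p).negOnePow • barSubst A.m y (fun y' => f x y' p q)

theorem cmp_apply (e : ℤ) (f : Fam A P Q) (g : Fam A M P) (x y : A.Word) (p q : ℤ) (v : M p) :
    cmp e f g x y p q v = splitSum x fun x₁ x₂ => splitSum y fun y₁ y₂ =>
      (e * wdeg x₁).negOnePow •
        through f g x₁ y₂ x₂ y₁ p (wdeg x₂ + p + wdeg y₁ + e) q v := by
  simp [cmp, splitSum, LinearMap.sum_apply, Units.smul_def]

theorem bar_apply (f : Fam A M P) (x y : A.Word) (p q : ℤ) (v : M p) :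
    bar f x y p q v = barSubst A.m x (fun x' => f x' y p q v) +
      (wdeg x + p).negOnePow • barSubst A.m y (fun y' => f x y' p q v) := by
  simp [bar, AInfBimodule.barSubst_apply, Units.smul_def]

theorem compHat_eq (f : Fam A M P) (b : Fam A M M) : f.compHat b = bar f + cmp 1 f b := by
  funext x y p q
  simp only [compHat, bar, cmp, splitSum, Pi.add_apply, one_mul, through]
  abel

theorem comp_eq (f : Fam A P Q) (g : Fam A M P) : f.comp g = cmp 0 f g := by
  funext x y p q
  simp only [cmp, splitSum, zero_mul, Int.negOnePow_zero, one_smul, add_zero]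
  rfl

/-- Both sides sum over factorisations of `x` and `y` into three words, with the same Koszul sign.
The total degree is a separate variable, so that sums such as `1 + -1` can be used as the literal
`0`. -/
theorem cmp_assoc {e e₁ e₂ : ℤ} (h : Fam A Q R) (g : Fam A P Q) (f : Fam A M P)
    (he : e = e₁ + e₂) : cmp e₁ (cmp e₂ h g) f = cmp e h (cmp e₁ g f) := by
  subst he
  funext x y p q
  ext v
  let T (x₁ x₂ x₃ y₁ y₂ y₃ : A.Word) : R q :=
    (e₁ * wdeg x₂ + (e₁ + e₂) * wdeg x₁).negOnePow •
      through h g x₁ y₃ x₂ y₂ (wdeg x₃ + p + wdeg y₁ + e₁)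
        (wdeg x₂ + (wdeg x₃ + p + wdeg y₁ + e₁) + wdeg y₂ + e₂) q
        (f x₃ y₁ p (wdeg x₃ + p + wdeg y₁ + e₁) v)
  have lhs : cmp e₁ (cmp e₂ h g) f x y p q v = splitSum x fun l x₃ => splitSum l fun x₁ x₂ =>
      splitSum y fun y₁ r => splitSum r fun y₂ y₃ => T x₁ x₂ x₃ y₁ y₂ y₃ := by
    rw [cmp_apply]
    refine splitSum_congr fun l x₃ _ => ?_
    rw [splitSum_comm]
    refine splitSum_congr fun y₁ r _ => ?_
    rw [through_apply, cmp_apply, ← splitSum_smul]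
    refine splitSum_congr fun x₁ x₂ hl => ?_
    rw [← splitSum_smul]
    refine splitSum_congr fun y₂ y₃ hr => ?_
    rw [smul_smul, ← Int.negOnePow_add, ← hl, wdeg_append]
    congr 2
    ring
  have rhs : cmp (e₁ + e₂) h (cmp e₁ g f) x y p q v =
      splitSum x fun x₁ r => splitSum r fun x₂ x₃ =>
      splitSum y fun l y₃ => splitSum l fun y₁ y₂ => T x₁ x₂ x₃ y₁ y₂ y₃ := by
    rw [cmp_apply]
    refine splitSum_congr fun x₁ r hr => ?_
    rw [splitSum_comm]
    refine splitSum_congr fun l y₃ hl => ?_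
    rw [through_apply, cmp_apply, splitSum_map, ← splitSum_smul]
    refine splitSum_congr fun x₂ x₃ hr => ?_
    rw [splitSum_map, ← splitSum_smul]
    refine splitSum_congr fun y₁ y₂ hl => ?_
    rw [LinearMap.map_smul_of_tower, smul_smul, ← Int.negOnePow_add, ← hl, ← hr, wdeg_append,
      wdeg_append]
    dsimp only [T]
    rw [show wdeg x₂ + wdeg x₃ + p + (wdeg y₁ + wdeg y₂) + (e₁ + e₂) =
      wdeg x₂ + (wdeg x₃ + p + wdeg y₁ + e₁) + wdeg y₂ + e₂ by ring,
      add_comm ((e₁ + e₂) * wdeg x₁)]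
    rfl
  rw [lhs, rhs, ← splitSum_assoc]
  simp only [splitSum_assoc]

/-- Once the substituted word is factored, the new letter lies either among the inputs of `f` or
among those of `g`. Moving the odd substitution past `g` costs `(-1)^e`. -/
theorem bar_cmp (e : ℤ) (f : Fam A P Q) (g : Fam A M P) :
    bar (cmp e f g) = cmp (e + 1) f (bar g) + e.negOnePow • cmp e (bar f) g := by
  funext x y p q
  ext v
  let T (x₁ x₂ y₁ y₂ : A.Word) (s : ℤ) : Q q := through f g x₁ y₂ x₂ y₁ p s q v
  have hx : barSubst A.m x (fun x' => cmp e f g x' y p q v) =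
      (splitSum x fun x₁ x₂ => splitSum y fun y₁ y₂ => (e * wdeg x₁ + e).negOnePow •
        barSubst A.m x₁ fun x' => T x' x₂ y₁ y₂ (wdeg x₂ + p + wdeg y₁ + e)) +
      splitSum x fun x₁ x₂ => splitSum y fun y₁ y₂ => (wdeg x₁ + e * wdeg x₁).negOnePow •
        barSubst A.m x₂ fun x' => T x₁ x' y₁ y₂ (wdeg x₂ + p + wdeg y₁ + (e + 1)) := by
    simp only [cmp_apply, barSubst_splitSum, barSubst_splitSum_comm]
    congr 1
    · refine splitSum_congr fun x₁ x₂ _ => splitSum_congr fun y₁ y₂ _ => ?_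
      rw [← barSubst_smul]
      refine barSubst_congr _ _ _ _ fun x' hx' => ?_
      rw [hx', mul_add, mul_one]
    · refine splitSum_congr fun x₁ x₂ _ => ?_
      rw [← splitSum_smul]
      refine splitSum_congr fun y₁ y₂ _ => ?_
      rw [barSubst_smul, smul_smul, ← Int.negOnePow_add]
      congr 1
      refine barSubst_congr _ _ _ _ fun x' hx' => ?_
      rw [hx', show wdeg x₂ + 1 + p + wdeg y₁ + e = wdeg x₂ + p + wdeg y₁ + (e + 1) by ring]
  have hy : (wdeg x + p).negOnePow • barSubst A.m y (fun y' => cmp e f g x y' p q v) =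
      (splitSum x fun x₁ x₂ => splitSum y fun y₁ y₂ =>
        (wdeg x₁ + wdeg x₂ + p + e * wdeg x₁).negOnePow •
        barSubst A.m y₁ fun y' => T x₁ x₂ y' y₂ (wdeg x₂ + p + wdeg y₁ + (e + 1))) +
      splitSum x fun x₁ x₂ => splitSum y fun y₁ y₂ =>
        (wdeg x₁ + wdeg x₂ + p + e * wdeg x₁ + wdeg y₁).negOnePow •
        barSubst A.m y₂ fun y' => T x₁ x₂ y₁ y' (wdeg x₂ + p + wdeg y₁ + e) := by
    simp only [cmp_apply, barSubst_splitSum_comm, barSubst_splitSum, splitSum_add, smul_add]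
    congr 1
    · rw [← splitSum_smul]
      refine splitSum_congr fun x₁ x₂ hx => ?_
      rw [← splitSum_smul]
      refine splitSum_congr fun y₁ y₂ _ => ?_
      rw [barSubst_smul, smul_smul, ← Int.negOnePow_add, ← hx, wdeg_append]
      congr 1
      refine barSubst_congr _ _ _ _ fun x' hx' => ?_
      rw [hx', show wdeg x₂ + p + (wdeg y₁ + 1) + e = wdeg x₂ + p + wdeg y₁ + (e + 1) by ring]
    · rw [← splitSum_smul]
      refine splitSum_congr fun x₁ x₂ hx => ?_
      rw [← splitSum_smul]
      refine splitSum_congr fun y₁ y₂ _ => ?_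
      rw [barSubst_smul, smul_smul, smul_smul, ← Int.negOnePow_add, ← Int.negOnePow_add, ← hx,
        wdeg_append]
      congr 2
      ring
  have hf : (e.negOnePow • cmp e (bar f) g) x y p q v =
      (splitSum x fun x₁ x₂ => splitSum y fun y₁ y₂ => (e * wdeg x₁ + e).negOnePow •
        barSubst A.m x₁ fun x' => T x' x₂ y₁ y₂ (wdeg x₂ + p + wdeg y₁ + e)) +
      splitSum x fun x₁ x₂ => splitSum y fun y₁ y₂ =>
        (wdeg x₁ + wdeg x₂ + p + e * wdeg x₁ + wdeg y₁).negOnePow •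
        barSubst A.m y₂ fun y' => T x₁ x₂ y₁ y' (wdeg x₂ + p + wdeg y₁ + e) := by
    change e.negOnePow • cmp e (bar f) g x y p q v = _
    rw [cmp_apply, ← splitSum_smul, ← splitSum_add]
    refine splitSum_congr fun x₁ x₂ _ => ?_
    rw [← splitSum_smul, ← splitSum_add]
    refine splitSum_congr fun y₁ y₂ _ => ?_
    rw [through_apply, bar_apply]
    simp only [smul_add, smul_smul, ← Int.negOnePow_add]
    congr 2
    · rw [add_comm]
    · apply AInfBimodule.negOnePow_congr
      push_cast
      have h2 : (2 : ZMod 2) = 0 := rfl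
      linear_combination (e : ZMod 2) * h2
  have hg : cmp (e + 1) f (bar g) x y p q v =
      (splitSum x fun x₁ x₂ => splitSum y fun y₁ y₂ => (wdeg x₁ + e * wdeg x₁).negOnePow •
        barSubst A.m x₂ fun x' => T x₁ x' y₁ y₂ (wdeg x₂ + p + wdeg y₁ + (e + 1))) +
      splitSum x fun x₁ x₂ => splitSum y fun y₁ y₂ =>
        (wdeg x₁ + wdeg x₂ + p + e * wdeg x₁).negOnePow •
        barSubst A.m y₁ fun y' => T x₁ x₂ y' y₂ (wdeg x₂ + p + wdeg y₁ + (e + 1)) := by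
    rw [cmp_apply, ← splitSum_add]
    refine splitSum_congr fun x₁ x₂ _ => ?_
    rw [← splitSum_add]
    refine splitSum_congr fun y₁ y₂ _ => ?_
    have hl : ∀ (z : A.Word) (s : ℤ) (G : A.Word → P s),
        f x₁ y₂ s q (barSubst A.m z G) = barSubst A.m z (fun z' => f x₁ y₂ s q (G z')) :=
      fun z s G => barSubst_map A.m z G (f x₁ y₂ s q).toAddMonoidHom
    rw [through_apply, bar_apply, map_add, LinearMap.map_smul_of_tower, hl, hl, smul_add, smul_smul,
      ← Int.negOnePow_add]
    congr 3 <;> ring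
  rw [bar_apply, hx, hy]
  change _ = cmp (e + 1) f (bar g) x y p q v + (e.negOnePow • cmp e (bar f) g) x y p q v
  rw [hf, hg]
  abel

end Fam

/-! ### Linearity, constant families and regularity -/

namespace Fam

variable {K : Type u} [Field K] {A : AInfAlgebra.{u, v} K}
variable {M P Q : ℤ → Type*} [∀ p, AddCommGroup (M p)] [∀ p, Module K (M p)]
  [∀ p, AddCommGroup (P p)] [∀ p, Module K (P p)] [∀ p, AddCommGroup (Q p)]
  [∀ p, Module K (Q p)]

section Bilinear

theorem cmp_add_left (e : ℤ) (f f' : Fam A P Q) (g : Fam A M P) :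
    cmp e (f + f') g = cmp e f g + cmp e f' g := by
  funext x y p q
  ext v
  change _ = cmp e f g x y p q v + cmp e f' g x y p q v
  simp only [cmp_apply, ← splitSum_add, ← smul_add]
  rfl

theorem cmp_add_right (e : ℤ) (f : Fam A P Q) (g g' : Fam A M P) :
    cmp e f (g + g') = cmp e f g + cmp e f g' := by
  funext x y p q
  ext v
  change _ = cmp e f g x y p q v + cmp e f g' x y p q v
  simp only [cmp_apply, ← splitSum_add, ← smul_add, through_apply, ← map_add]
  rfl

theorem cmp_sub_left (e : ℤ) (f f' : Fam A P Q) (g : Fam A M P) :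
    cmp e (f - f') g = cmp e f g - cmp e f' g := by
  rw [eq_sub_iff_add_eq, ← cmp_add_left, sub_add_cancel]

theorem cmp_sub_right (e : ℤ) (f : Fam A P Q) (g g' : Fam A M P) :
    cmp e f (g - g') = cmp e f g - cmp e f g' := by
  rw [eq_sub_iff_add_eq, ← cmp_add_right, sub_add_cancel]

@[simp]
theorem cmp_zero_left (e : ℤ) (g : Fam A M P) : cmp e (0 : Fam A P Q) g = 0 := by
  simpa using cmp_sub_left e (0 : Fam A P Q) 0 g

@[simp]
theorem cmp_zero_right (e : ℤ) (f : Fam A P Q) : cmp e f (0 : Fam A M P) = 0 := by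
  simpa using cmp_sub_right e f (0 : Fam A M P) 0

theorem cmp_neg_left (e : ℤ) (f : Fam A P Q) (g : Fam A M P) :
    cmp e (-f) g = -cmp e f g := by
  rw [← zero_sub, cmp_sub_left, cmp_zero_left, zero_sub]

theorem cmp_neg_right (e : ℤ) (f : Fam A P Q) (g : Fam A M P) :
    cmp e f (-g) = -cmp e f g := by
  rw [← zero_sub, cmp_sub_right, cmp_zero_right, zero_sub]

theorem bar_add (f f' : Fam A M P) : bar (f + f') = bar f + bar f' := by
  funext x y p q
  simp only [bar, Pi.add_apply, barSubst_add, smul_add]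
  abel

theorem bar_sub (f f' : Fam A M P) : bar (f - f') = bar f - bar f' := by
  rw [eq_sub_iff_add_eq, ← bar_add, sub_add_cancel]

@[simp]
theorem bar_zero : bar (0 : Fam A M P) = 0 := by
  simpa using bar_sub (0 : Fam A M P) 0

/-- The substitutions on the left and on the right each square to zero, and the sign `(-1)^(|x| +
p)` makes them anticommute. -/
theorem bar_bar {f : Fam A M P} (hf : f.IsMultilinear) : bar (bar f) = 0 := by
  funext x y p q
  have hl : A.WordLinear (fun x => f x y p q) := fun x z d c a a' => hf.left x z y d c a a' p q
  have hr : A.WordLinear (fun y => f x y p q) := fun y z d c a a' => hf.right x y z d c a a' p q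
  have h : barSubst A.m x (fun x' => bar f x' y p q) =
      -((wdeg x + p).negOnePow •
        barSubst A.m y (fun y' => barSubst A.m x (fun x' => f x' y' p q))) := by
    simp only [bar]
    rw [barSubst_add, AInfAlgebra.barSubst_barSubst hl, zero_add, barSubst_comm, ← Units.neg_smul,
      ← Int.negOnePow_succ, ← barSubst_smul]
    refine barSubst_congr _ _ _ _ fun x' hx => ?_
    rw [hx, add_right_comm]
  rw [bar, h]
  simp only [bar, barSubst_add, barSubst_smul, AInfAlgebra.barSubst_barSubst hr, smul_zero,
    add_zero, neg_add_cancel]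
  rfl

end Bilinear

section Const

/-- The family whose only component is the one without inputs from `A`. -/
def const (u : ∀ p q : ℤ, M p →ₗ[K] P q) : Fam A M P
  | [], [], p, q => u p q
  | _, _, _, _ => 0

@[simp]
theorem const_nil (u : ∀ p q : ℤ, M p →ₗ[K] P q) : const (A := A) u [] [] = u := rfl

theorem const_of_ne (u : ∀ p q : ℤ, M p →ₗ[K] P q) {x y : A.Word} (h : x ≠ [] ∨ y ≠ []) (p q : ℤ) :
    const u x y p q = 0 := by
  cases x <;> cases y <;> simp_all [const]

theorem const_multilinear (u : ∀ p q : ℤ, M p →ₗ[K] P q) : (const (A := A) u).IsMultilinear := by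
  constructor <;> intros <;> simp [const_of_ne]

theorem const_hasDegree {u : ∀ p q : ℤ, M p →ₗ[K] P q} {e : ℤ} (h : ∀ p q, q ≠ p + e → u p q = 0) :
    (const (A := A) u).HasDegree e := by
  intro x y p q hq
  rcases x with _ | ⟨a, x⟩
  · rcases y with _ | ⟨b, y⟩
    · exact h p q (by simpa using hq)
    · exact const_of_ne u (by simp) p q
  · exact const_of_ne u (by simp) p q

@[simp]
theorem bar_const (u : ∀ p q : ℤ, M p →ₗ[K] P q) : bar (const (A := A) u) = 0 := by
  have h : ∀ (x y : A.Word) (p q : ℤ),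
      barSubst A.m x (fun x' => const (A := A) u x' y p q) = 0 ∧
      barSubst A.m x (fun x' => const (A := A) u y x' p q) = 0 := by
    intro x y p q
    constructor <;> refine Finset.sum_eq_zero fun i _ => Finset.sum_eq_zero fun r _ => ?_
    · exact (congrArg _ (const_of_ne u (Or.inl (by simp)) p q)).trans (smul_zero _)
    · exact (congrArg _ (const_of_ne u (Or.inr (by simp)) p q)).trans (smul_zero _)
  funext x y p q
  rw [bar, (h x y p q).1, (h y x p q).2, smul_zero, add_zero]
  rfl

theorem const_cmp (e : ℤ) (u : ∀ p q : ℤ, P p →ₗ[K] Q q) (f : Fam A M P) (x y : A.Word) (p q : ℤ) :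
    cmp e (const u) f x y p q =
      u (wdeg x + p + wdeg y + e) q ∘ₗ f x y p (wdeg x + p + wdeg y + e) := by
  rw [cmp, splitSum_left_nil, splitSum_right_nil]
  · simp [through]
  · intro y₁ y₂ h
    rw [through, const_of_ne u (Or.inr h), LinearMap.zero_comp, smul_zero]
  · intro x₁ x₂ h
    rw [← splitSum_zero y]
    refine splitSum_congr fun y₁ y₂ _ => ?_
    rw [through, const_of_ne u (Or.inl h), LinearMap.zero_comp, smul_zero]

theorem cmp_const (e : ℤ) (f : Fam A P Q) (u : ∀ p q : ℤ, M p →ₗ[K] P q) (x y : A.Word) (p q : ℤ) :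
    cmp e f (const u) x y p q = (e * wdeg x).negOnePow • f x y (p + e) q ∘ₗ u p (p + e) := by
  rw [cmp, splitSum_right_nil, splitSum_left_nil]
  · rw [wdeg_nil, zero_add, add_zero]
    rfl
  · intro y₁ y₂ h
    rw [through, const_of_ne u (Or.inr h), LinearMap.comp_zero, smul_zero]
  · intro x₁ x₂ h
    rw [← splitSum_zero y]
    refine splitSum_congr fun y₁ y₂ _ => ?_
    rw [through, const_of_ne u (Or.inl h), LinearMap.comp_zero, smul_zero]

theorem const_cmp_const (e : ℤ) (u : ∀ p q : ℤ, P p →ₗ[K] Q q) (w : ∀ p q : ℤ, M p →ₗ[K] P q) :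
    cmp e (const (A := A) u) (const w) = const (fun p q => u (p + e) q ∘ₗ w p (p + e)) := by
  funext x y p q
  rw [cmp_const]
  by_cases h : x = [] ∧ y = []
  · obtain ⟨rfl, rfl⟩ := h
    simp
  · have h : x ≠ [] ∨ y ≠ [] := by tauto
    rw [const_of_ne u h, const_of_ne _ h, LinearMap.zero_comp, smul_zero]

theorem cmp_nil (e : ℤ) (f : Fam A P Q) (g : Fam A M P) (p q : ℤ) :
    cmp e f g [] [] p q = f [] [] (p + e) q ∘ₗ g [] [] p (p + e) := by
  simp only [cmp, splitSum_nil, wdeg_nil, mul_zero, Int.negOnePow_zero, one_smul, zero_add,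
    add_zero]
  rfl

theorem bar_nil (f : Fam A M P) (p q : ℤ) : bar f [] [] p q = 0 := by
  simp [bar]

/-- A family of maps preserving degrees, extended by zero. -/
def diag (u : ∀ p : ℤ, M p →ₗ[K] P p) (p q : ℤ) : M p →ₗ[K] P q :=
  if h : p = q then h ▸ u p else 0

@[simp]
theorem diag_self (u : ∀ p : ℤ, M p →ₗ[K] P p) (p : ℤ) : diag u p p = u p := by
  simp [diag]

theorem diag_of_ne (u : ∀ p : ℤ, M p →ₗ[K] P p) {p q : ℤ} (h : p ≠ q) : diag u p q = 0 := by
  simp [diag, h]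

theorem const_diag_hasDegree (u : ∀ p : ℤ, M p →ₗ[K] P p) :
    (const (A := A) (diag u)).HasDegree 0 :=
  const_hasDegree fun p q h => diag_of_ne u (by lia)

theorem const_diag_cmp (u : ∀ p : ℤ, P p →ₗ[K] Q p) (w : ∀ p : ℤ, M p →ₗ[K] P p) :
    cmp 0 (const (A := A) (diag u)) (const (diag w)) = const (diag fun p => u p ∘ₗ w p) := by
  rw [const_cmp_const]
  congr 1
  funext p q
  rw [add_zero, diag_self]
  by_cases h : p = q
  · subst h
    simp
  · rw [diag_of_ne u h, diag_of_ne _ h, LinearMap.zero_comp]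

variable (A M) in
/-- The identity family. -/
def one : Fam A M M := const (diag fun _ => LinearMap.id)

theorem one_cmp {e : ℤ} {f : Fam A M P} (hf : f.HasDegree e) : cmp e (one A P) f = f := by
  funext x y p q
  rw [one, const_cmp]
  by_cases h : q = wdeg x + p + wdeg y + e
  · subst h
    rw [diag_self, LinearMap.id_comp]
  · rw [diag_of_ne _ (Ne.symm h), hf _ _ _ _ h, LinearMap.zero_comp]

theorem cmp_one (f : Fam A M P) : cmp 0 f (one A M) = f := by
  funext x y p q
  rw [one, cmp_const, zero_mul, Int.negOnePow_zero, one_smul, add_zero, diag_self,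
    LinearMap.comp_id]

theorem one_nil (p : ℤ) : one A M [] [] p p = LinearMap.id := by
  rw [one, const_nil, diag_self]

end Const

section Regular

/-- Multilinear families that are homogeneous of degree `e`. -/
structure IsRegular (e : ℤ) (f : Fam A M P) : Prop where
  multilinear : f.IsMultilinear
  degree : f.HasDegree e

theorem IsRegular.zero (e : ℤ) : IsRegular e (0 : Fam A M P) where
  multilinear := by constructor <;> intros <;> simp
  degree := fun _ _ _ _ _ => rfl

theorem IsRegular.add {e : ℤ} {f g : Fam A M P} (hf : f.IsRegular e) (hg : g.IsRegular e) :
    (f + g).IsRegular e where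
  multilinear := by
    constructor
    · intros
      simp only [Pi.add_apply, hf.multilinear.left, hg.multilinear.left, smul_add]
      abel
    · intros
      simp only [Pi.add_apply, hf.multilinear.right, hg.multilinear.right, smul_add]
      abel
  degree := fun x y p q h => by
    rw [Pi.add_apply, Pi.add_apply, Pi.add_apply, Pi.add_apply, hf.degree _ _ _ _ h,
      hg.degree _ _ _ _ h, add_zero]

theorem IsRegular.smul {e : ℤ} {f : Fam A M P} (hf : f.IsRegular e) (k : K) :
    (k • f).IsRegular e where
  multilinear := by
    constructor
    · intros
      simp only [Pi.smul_apply, hf.multilinear.left, smul_add, smul_comm k]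
    · intros
      simp only [Pi.smul_apply, hf.multilinear.right, smul_add, smul_comm k]
  degree := fun x y p q h => by
    rw [Pi.smul_apply, Pi.smul_apply, Pi.smul_apply, Pi.smul_apply, hf.degree _ _ _ _ h, smul_zero]

theorem IsRegular.sub {e : ℤ} {f g : Fam A M P} (hf : f.IsRegular e) (hg : g.IsRegular e) :
    (f - g).IsRegular e := by
  rw [sub_eq_add_neg, ← neg_one_smul K]
  exact hf.add (hg.smul _)

theorem IsRegular.const {e : ℤ} {u : ∀ p q : ℤ, M p →ₗ[K] P q} (h : ∀ p q, q ≠ p + e → u p q = 0) :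
    (const (A := A) u).IsRegular e :=
  ⟨const_multilinear u, const_hasDegree h⟩

theorem IsRegular.const_diag (u : ∀ p : ℤ, M p →ₗ[K] P p) :
    (Fam.const (A := A) (diag u)).IsRegular 0 :=
  ⟨const_multilinear _, const_diag_hasDegree u⟩

theorem IsRegular.one : (one A M).IsRegular 0 := IsRegular.const_diag _

theorem IsRegular.cmp {e e₁ e₂ : ℤ} {f : Fam A P Q} {g : Fam A M P} (hf : f.IsRegular e₁)
    (hg : g.IsRegular e₂) (he : e = e₁ + e₂) : (Fam.cmp e₂ f g).IsRegular e where
  multilinear := by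
    constructor
    · intro x z y d c a a' p q
      have hd : ∀ b : A.carrier d, ∀ x z : A.Word,
          wdeg (x ++ ⟨d, b⟩ :: z) = wdeg x + (d + wdeg z) := by
        intro b x z; simp [wdeg_append, wdeg_cons]
      refine splitSum_linear c (⟨d, c • a + a'⟩ : Homog A.carrier) ⟨d, a⟩ ⟨d, a'⟩ x z _ ?_ ?_
      · intro u u' t
        rw [← splitSum_smul, ← splitSum_add]
        refine splitSum_congr fun y₁ y₂ _ => ?_
        simp only [hd, through, hf.multilinear.left, LinearMap.add_comp, LinearMap.smul_comp,
          smul_add, smul_comm c]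
      · intro t u u'
        rw [← splitSum_smul, ← splitSum_add]
        refine splitSum_congr fun y₁ y₂ _ => ?_
        simp only [hd]
        simp only [through, hg.multilinear.left, LinearMap.comp_add, LinearMap.comp_smul,
          smul_add, smul_comm c]
    · intro x y z d c a a' p q
      have hd : ∀ b : A.carrier d, ∀ x z : A.Word,
          wdeg (x ++ ⟨d, b⟩ :: z) = wdeg x + (d + wdeg z) := by
        intro b x z; simp [wdeg_append, wdeg_cons]
      simp only [Fam.cmp]
      rw [← splitSum_smul, ← splitSum_add]
      refine splitSum_congr fun x₁ x₂ _ => ?_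
      refine splitSum_linear c (⟨d, c • a + a'⟩ : Homog A.carrier) ⟨d, a⟩ ⟨d, a'⟩ y z _ ?_ ?_
      · intro u u' t
        simp only [hd]
        simp only [through, hg.multilinear.right, LinearMap.comp_add, LinearMap.comp_smul,
          smul_add, smul_comm c]
      · intro t u u'
        simp only [through, hf.multilinear.right, LinearMap.add_comp, LinearMap.smul_comp,
          smul_add, smul_comm c]
  degree := fun x y p q h => by
    rw [Fam.cmp, ← splitSum_zero x]
    refine splitSum_congr fun x₁ x₂ hx => ?_
    rw [← splitSum_zero y]
    refine splitSum_congr fun y₁ y₂ hy => ?_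
    rw [← hx, ← hy, wdeg_append, wdeg_append] at h
    rw [through, hf.degree _ _ _ _ (by lia), LinearMap.zero_comp, smul_zero]

theorem IsRegular.bar {e : ℤ} {f : Fam A M P} (hf : f.IsRegular e) :
    (Fam.bar f).IsRegular (e + 1) where
  multilinear := by
    constructor
    · intro x z y d c a a' p q
      have hd : ∀ b : A.carrier d, wdeg (x ++ ⟨d, b⟩ :: z) = wdeg x + (d + wdeg z) := by
        intro b; simp [wdeg_append, wdeg_cons]
      have hf' : A.WordLinear (fun x => f x y p q) :=
        fun x z d c a a' => hf.multilinear.left x z y d c a a' p q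
      have hl := AInfAlgebra.wordLinear_barSubst hf' x z d c a a'
      simp only at hl
      simp only [Fam.bar, hl, hd, hf.multilinear.left, barSubst_add, barSubst_smul, smul_add,
        smul_comm c]
      abel
    · intro x y z d c a a' p q
      have hf' : A.WordLinear (fun y => f x y p q) :=
        fun y z d c a a' => hf.multilinear.right x y z d c a a' p q
      have hl := AInfAlgebra.wordLinear_barSubst hf' y z d c a a'
      simp only at hl
      simp only [Fam.bar, hl, hf.multilinear.right, barSubst_add, barSubst_smul, smul_add,
        smul_comm c]
      abel
  degree := by
    have h := AInfBimodule.compHat_degree f (0 : Fam A M M) e hf.degree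
    rwa [compHat_eq, cmp_zero_right, add_zero] at h

end Regular

/-! ### Filtration by word length and fixed points -/

section Fixed

/-- The families `f` and `g` agree on inputs with fewer than `n` elements of `A`. -/
def AgreeBelow (n : ℕ) (f g : Fam A M P) : Prop :=
  ∀ x y : A.Word, x.length + y.length < n → f x y = g x y

theorem AgreeBelow.refl (n : ℕ) (f : Fam A M P) : AgreeBelow n f f := fun _ _ _ => rfl

theorem AgreeBelow.add {n : ℕ} {f g f' g' : Fam A M P} (h : AgreeBelow n f g)
    (h' : AgreeBelow n f' g') : AgreeBelow n (f + f') (g + g') := fun x y hn => by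
  simp only [Pi.add_apply, h x y hn, h' x y hn]

theorem AgreeBelow.smul {n : ℕ} {f g : Fam A M P} (h : AgreeBelow n f g) (c : K) :
    AgreeBelow n (c • f) (c • g) := fun x y hn => by
  simp only [Pi.smul_apply, h x y hn]

theorem AgreeBelow.sub {n : ℕ} {f g f' g' : Fam A M P} (h : AgreeBelow n f g)
    (h' : AgreeBelow n f' g') : AgreeBelow n (f - f') (g - g') := fun x y hn => by
  simp only [Pi.sub_apply, h x y hn, h' x y hn]

theorem AgreeBelow.of_through {n : ℕ} (e : ℤ) {f f' : Fam A P Q} {g g' : Fam A M P}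
    (h : ∀ x₁ y₂ x₂ y₁ : A.Word, x₁.length + y₂.length + (x₂.length + y₁.length) < n →
      through f g x₁ y₂ x₂ y₁ = through f' g' x₁ y₂ x₂ y₁) :
    AgreeBelow n (cmp e f g) (cmp e f' g') := by
  intro x y hn
  funext p q
  refine splitSum_congr fun x₁ x₂ hx => splitSum_congr fun y₁ y₂ hy => ?_
  rw [h]
  rw [← hx, ← hy, List.length_append, List.length_append] at hn
  lia

theorem AgreeBelow.cmp {n : ℕ} (e : ℤ) {f f' : Fam A P Q} {g g' : Fam A M P}
    (hf : AgreeBelow n f f') (hg : AgreeBelow n g g') :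
    AgreeBelow n (cmp e f g) (cmp e f' g') := by
  refine .of_through e fun x₁ y₂ x₂ y₁ hn => ?_
  funext p s q
  rw [through, through, hf _ _ (by lia), hg _ _ (by lia)]

/-- A factor without constant part consumes at least one letter, so the other factor sees a shorter
word. This gain of one letter is what makes the operators below contracting. -/
theorem AgreeBelow.cmp_succ {n : ℕ} (e : ℤ) {f f' : Fam A P Q} {g g' : Fam A M P}
    (hf : AgreeBelow n f f') (hg : AgreeBelow n g g')
    (hf0 : f [] [] = 0) (hf0' : f' [] [] = 0)
    (hg0 : AgreeBelow (n + 1) f f' ∨ g [] [] = 0 ∧ g' [] [] = 0) :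
    AgreeBelow (n + 1) (Fam.cmp e f g) (Fam.cmp e f' g') := by
  refine .of_through e fun x₁ y₂ x₂ y₁ hn => ?_
  funext p s q
  rw [through, through]
  by_cases h1 : x₁.length + y₂.length = 0
  · obtain ⟨rfl, rfl⟩ : x₁ = [] ∧ y₂ = [] := by simpa using h1
    simp [hf0, hf0']
  · rw [hg _ _ (by lia)]
    rcases hg0 with hf | ⟨hg0, hg0'⟩
    · rw [hf _ _ (by lia)]
    · by_cases h2 : x₂.length + y₁.length = 0
      · obtain ⟨rfl, rfl⟩ : x₂ = [] ∧ y₁ = [] := by simpa using h2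
        simp [hg0']
      · rw [hf _ _ (by lia)]

theorem AgreeBelow.cmp_left {n : ℕ} (e : ℤ) {f f' : Fam A P Q} {g : Fam A M P}
    (hf : AgreeBelow n f f') (hg : g [] [] = 0) :
    AgreeBelow (n + 1) (Fam.cmp e f g) (Fam.cmp e f' g) := by
  refine .of_through e fun x₁ y₂ x₂ y₁ hn => ?_
  funext p s q
  rw [through, through]
  by_cases h2 : x₂.length + y₁.length = 0
  · obtain ⟨rfl, rfl⟩ : x₂ = [] ∧ y₁ = [] := by simpa using h2
    simp [hg]
  · rw [hf _ _ (by lia)]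

theorem AgreeBelow.cmp_right {n : ℕ} (e : ℤ) {f : Fam A P Q} {g g' : Fam A M P}
    (hg : AgreeBelow n g g') (hf : f [] [] = 0) :
    AgreeBelow (n + 1) (Fam.cmp e f g) (Fam.cmp e f g') :=
  .cmp_succ e (.refl n f) hg hf hf (.inl (.refl _ f))

/-- A contracting operator on families has a fixed point. -/
theorem exists_fixed (Good : Fam A M P → Prop) (Φ : Fam A M P → Fam A M P) (zero : Good 0)
    (maps : ∀ f, Good f → Good (Φ f))
    (limit : ∀ f, (∀ n, ∃ g, Good g ∧ AgreeBelow n f g) → Good f)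
    (contract : ∀ n f g, Good f → Good g → AgreeBelow n f g → AgreeBelow (n + 1) (Φ f) (Φ g)) :
    ∃ f, Good f ∧ Φ f = f := by
  let F (n : ℕ) : Fam A M P := Φ^[n] 0
  have hF : ∀ n, Φ (F n) = F (n + 1) := fun n => (Function.iterate_succ_apply' Φ n 0).symm
  have good : ∀ n, Good (F n) := fun n => by
    induction n with
    | zero => exact zero
    | succ n ih => rw [← hF]; exact maps _ ih
  have step : ∀ n, AgreeBelow n (F n) (F (n + 1)) := fun n => by
    induction n with
    | zero => intro x y h; lia
    | succ n ih => rw [← hF, ← hF (n + 1)]; exact contract n _ _ (good _) (good _) ih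
  have stable : ∀ n k, AgreeBelow n (F n) (F (n + k)) := fun n k => by
    induction k with
    | zero => exact .refl _ _
    | succ k ih => exact fun x y h => (ih x y h).trans (step (n + k) x y (by lia))
  -- On words with `m` letters in total the iterates are stationary from index `m + 1` on; the shift
  -- is due to the strict inequality in `AgreeBelow`.
  let f : Fam A M P := fun x y => F (x.length + y.length + 1) x y
  have agree : ∀ n, AgreeBelow n f (F n) := fun n x y h => by
    obtain ⟨k, rfl⟩ : ∃ k, n = x.length + y.length + 1 + k :=
      ⟨n - (x.length + y.length + 1), by lia⟩
    exact stable _ k x y (by lia)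
  have hf : Good f := limit f fun n => ⟨F n, good n, agree n⟩
  refine ⟨f, hf, ?_⟩
  funext x y
  rw [contract _ _ _ hf (good _) (agree (x.length + y.length)) x y (by lia), hF,
    agree _ x y (Nat.lt_succ_self _)]

theorem eq_zero_of_agreeBelow (f : Fam A M P)
    (h : ∀ n, AgreeBelow n f 0 → AgreeBelow (n + 1) f 0) : f = 0 := by
  have all : ∀ n, AgreeBelow n f 0 := fun n => by
    induction n with
    | zero => intro x y h; lia
    | succ n ih => exact h n ih
  funext x y
  exact all _ x y (Nat.lt_succ_self _)

/-- Each instance of multilinearity or homogeneity involves words of a single total length, so it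
can be checked on one approximation. -/
theorem IsRegular.limit {e : ℤ} (f : Fam A M P)
    (h : ∀ n, ∃ g, IsRegular e g ∧ AgreeBelow n f g) : IsRegular e f where
  multilinear := by
    constructor
    · intro x z y d c a a' p q
      obtain ⟨g, hg, hfg⟩ := h (x.length + z.length + 1 + y.length + 1)
      simp only [hfg (x ++ _ :: z) y (by simp; lia), hg.multilinear.left]
    · intro x y z d c a a' p q
      obtain ⟨g, hg, hfg⟩ := h (x.length + z.length + 1 + y.length + 1)
      simp only [hfg x (y ++ _ :: z) (by simp; lia), hg.multilinear.right]
  degree := fun x y p q hq => by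
    obtain ⟨g, hg, hfg⟩ := h (x.length + y.length + 1)
    rw [hfg x y (by lia), hg.degree x y p q hq]

end Fixed

end Fam

theorem splitSum_neg {α M : Type*} [AddCommGroup M] (x : List α) (F : List α → List α → M) :
    splitSum x (fun x₁ x₂ => -F x₁ x₂) = -splitSum x F :=
  Finset.sum_neg_distrib _

/-! ### Duals and skew symmetric pairings -/

namespace Fam

variable {K : Type u} [Field K] {A : AInfAlgebra.{u, v} K}
variable {M P Q M' : ℤ → Type*} [∀ p, AddCommGroup (M p)] [∀ p, Module K (M p)]
  [∀ p, AddCommGroup (P p)] [∀ p, Module K (P p)] [∀ p, AddCommGroup (Q p)]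
  [∀ p, Module K (Q p)] [∀ p, AddCommGroup (M' p)] [∀ p, Module K (M' p)]

section Dual

variable (K) in
/-- The graded dual, shifted so that a functional of degree `p` is supported in degree `-N - p`. -/
abbrev GDual (M : ℤ → Type*) [∀ p, AddCommGroup (M p)] [∀ p, Module K (M p)] (N p : ℤ) : Type _ :=
  Module.Dual K (M (-N - p))

/-- The dual of a family of degree `e`, with Koszul signs. -/
def dual (N e : ℤ) (f : Fam A M P) : Fam A (GDual K P N) (GDual K M N) := fun x y p q =>
  (e * p + wdeg x * (p + wdeg y + (-N - q))).negOnePow • (f y x (-N - q) (-N - p)).dualMap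

theorem dual_apply (N e : ℤ) (f : Fam A M P) (x y : A.Word) (p q : ℤ) (φ : GDual K P N p)
    (w : M (-N - q)) : dual N e f x y p q φ w =
      (e * p + wdeg x * (p + wdeg y + (-N - q))).negOnePow • φ (f y x (-N - q) (-N - p) w) := by
  simp [dual, Units.smul_def]

theorem smul_functional_apply {V : Type*} [AddCommGroup V] [Module K V] (n : ℤ)
    (F : Module.Dual K V) (w : V) : (n.negOnePow • F) w = n.negOnePow • F w := by
  simp [Units.smul_def]

theorem IsRegular.dual {e : ℤ} {f : Fam A M P} (hf : f.IsRegular e) (N e' : ℤ) :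
    (Fam.dual N e' f).IsRegular e where
  multilinear := by
    constructor <;> intros <;> ext φ w <;>
    simp only [dual_apply, LinearMap.add_apply, LinearMap.smul_apply, hf.multilinear.left,
      hf.multilinear.right, map_add, map_smul, smul_add, wdeg_append, wdeg_cons] <;>
    rw [smul_comm]
  degree := fun x y p q h => by
    ext φ w
    rw [dual_apply, hf.degree y x (-N - q) (-N - p) (by lia)]
    simp

theorem dual_add (N e : ℤ) (f g : Fam A M P) : dual N e (f + g) = dual N e f + dual N e g := by
  funext x y p q
  ext φ w
  change _ = dual N e f x y p q φ w + dual N e g x y p q φ w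
  simp only [dual_apply, ← smul_add, ← map_add]
  rfl

theorem dual_nil (N : ℤ) (f : Fam A M P) (p q : ℤ) :
    dual N 0 f [] [] p q = (f [] [] (-N - q) (-N - p)).dualMap := by
  simp [dual]

theorem dual_one (N : ℤ) : dual N 0 (one A M) = one A (GDual K M N) := by
  funext x y p q
  ext φ w
  rw [dual_apply]
  by_cases h : x = [] ∧ y = []
  · obtain ⟨rfl, rfl⟩ := h
    by_cases h : p = q
    · subst h
      simp [one]
    · simp only [one, const_nil]
      rw [diag_of_ne _ h, diag_of_ne _ (by lia)]
      simp
  · have h : x ≠ [] ∨ y ≠ [] := by tauto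
    rw [one, one, const_of_ne _ h.symm, const_of_ne _ h]
    simp

theorem AgreeBelow.dual {n : ℕ} {f g : Fam A M P} (h : AgreeBelow n f g) (N e : ℤ) :
    AgreeBelow n (Fam.dual N e f) (Fam.dual N e g) := fun x y hn => by
  funext p q
  rw [Fam.dual, Fam.dual, h y x (by lia)]

theorem cmp_eval {N : ℤ} (e : ℤ) (f : Fam A P (GDual K Q N)) (g : Fam A M P) (x y : A.Word)
    (p q : ℤ) (v : M p) (w : Q (-N - q)) :
    cmp e f g x y p q v w = splitSum x fun x₁ x₂ => splitSum y fun y₁ y₂ =>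
      (e * wdeg x₁).negOnePow •
        through f g x₁ y₂ x₂ y₁ p (wdeg x₂ + p + wdeg y₁ + e) q v w := by
  rw [cmp_apply]
  simp [splitSum, LinearMap.sum_apply, Units.smul_def]

/-- Dualising reverses composition and exchanges left and right words. The signs are compared modulo
2 over all parities of the degrees. -/
theorem dual_cmp {e₁ e₂ e : ℤ} (N : ℤ) {f : Fam A P Q} {g : Fam A M P} (hf : f.IsRegular e₁)
    (hg : g.IsRegular e₂) (he : e = e₁ + e₂) : dual N e (cmp e₂ f g) =
      (e₁ * e₂).negOnePow • cmp e₁ (dual N e₂ g) (dual N e₁ f) := by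
  subst he
  funext x y p q
  change _ = (e₁ * e₂).negOnePow • cmp e₁ (dual N e₂ g) (dual N e₁ f) x y p q
  -- The signs agree only when `q` is the degree of the output; in all other degrees both sides
  -- vanish.
  by_cases hq : q = wdeg x + p + wdeg y + (e₁ + e₂)
  · ext φ w
    rw [LinearMap.smul_apply, smul_functional_apply, cmp_eval, dual_apply, cmp_apply, splitSum_map,
      splitSum_comm, ← splitSum_smul, ← splitSum_smul]
    refine splitSum_congr fun y₁ y₂ hy => ?_
    rw [splitSum_map, ← splitSum_smul, ← splitSum_smul]
    refine splitSum_congr fun x₁ x₂ hx => ?_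
    rw [LinearMap.map_smul_of_tower]
    rw [← hx, ← hy, wdeg_append, wdeg_append] at hq
    rw [through_apply, through_apply, dual_apply, dual_apply,
      show -N - (wdeg x₂ + p + wdeg y₁ + e₁) = wdeg y₂ + (-N - q) + wdeg x₁ + e₂ by lia]
    simp only [smul_smul, ← Int.negOnePow_add]
    congr 1
    rw [← hx, ← hy, wdeg_append, wdeg_append, hq]
    apply AInfBimodule.negOnePow_congr
    push_cast
    generalize (wdeg x₁ : ZMod 2) = a
    generalize (wdeg x₂ : ZMod 2) = a'
    generalize (wdeg y₁ : ZMod 2) = c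
    generalize (wdeg y₂ : ZMod 2) = c'
    generalize (N : ZMod 2) = n
    generalize (p : ZMod 2) = o
    generalize (e₁ : ZMod 2) = d
    generalize (e₂ : ZMod 2) = d'
    revert a a' c c' n o d d'
    decide
  · rw [((hf.cmp hg rfl).dual N _).degree x y p q hq,
      ((hg.dual N _).cmp (hf.dual N _) (add_comm e₁ e₂)).degree x y p q hq, smul_zero]

theorem dual_bar (N : ℤ) (f : Fam A M P) : dual N 1 (bar f) = bar (dual N 0 f) := by
  funext x y p q
  ext φ w
  have hl : ∀ (z : A.Word) (G : A.Word → P (-N - p)),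
      φ (barSubst A.m z G) = barSubst A.m z (fun z' => φ (G z')) := fun z G =>
    barSubst_map A.m z G φ.toAddMonoidHom
  rw [dual_apply, bar_apply, map_add, LinearMap.map_smul_of_tower, hl, hl, bar_apply,
    LinearMap.add_apply, smul_functional_apply, AInfBimodule.barSubst_apply,
    AInfBimodule.barSubst_apply]
  simp only [dual_apply]
  have hx : barSubst A.m x (fun x' => (0 * p + wdeg x' * (p + wdeg y + (-N - q))).negOnePow •
      φ (f y x' (-N - q) (-N - p) w)) = (0 * p + (wdeg x + 1) * (p + wdeg y + (-N - q))).negOnePow •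
        barSubst A.m x (fun x' => φ (f y x' (-N - q) (-N - p) w)) := by
    rw [← barSubst_smul]
    exact barSubst_congr _ _ _ _ fun x' hx => by rw [hx]
  have hy : barSubst A.m y (fun y' => (0 * p + wdeg x * (p + wdeg y' + (-N - q))).negOnePow •
      φ (f y' x (-N - q) (-N - p) w)) = (0 * p + wdeg x * (p + (wdeg y + 1) + (-N - q))).negOnePow •
        barSubst A.m y (fun y' => φ (f y' x (-N - q) (-N - p) w)) := by
    rw [← barSubst_smul]
    exact barSubst_congr _ _ _ _ fun y' hy => by rw [hy]
  rw [hx, hy, smul_add, smul_smul, smul_smul, ← Int.negOnePow_add, ← Int.negOnePow_add, add_comm]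
  have h2 : (2 : ZMod 2) = 0 := rfl
  congr 2 <;> apply AInfBimodule.negOnePow_congr <;> push_cast
  · ring
  · linear_combination -(wdeg x : ZMod 2) * h2

end Dual

section SkewPair

/-- The pairings `X` and `Y` are obtained from each other by exchanging the arguments, up to the
sign that expresses skew symmetry. -/
def SkewPair (N : ℤ) (X : Fam A M (GDual K P N)) (Y : Fam A P (GDual K M N)) : Prop :=
  ∀ (x y : A.Word) (p q : ℤ) (v : M (-N - p)) (w : P (-N - q)),
    X x y (-N - p) q v w =
      -(((wdeg x + (-N - p)) * (wdeg y + (-N - q))).negOnePow • Y y x (-N - q) p w v)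

variable {N : ℤ}

theorem SkewPair.symm {X : Fam A M (GDual K P N)} {Y : Fam A P (GDual K M N)}
    (h : SkewPair N X Y) : SkewPair N Y X := by
  intro x y p q v w
  rw [h, smul_neg, neg_neg, mul_comm, smul_smul, ← Int.negOnePow_add, Int.negOnePow_even, one_smul]
  exact Even.add_self _

theorem SkewPair.add {X X' : Fam A M (GDual K P N)} {Y Y' : Fam A P (GDual K M N)}
    (h : SkewPair N X Y) (h' : SkewPair N X' Y') : SkewPair N (X + X') (Y + Y') := by
  intro x y p q v w
  change X x y (-N - p) q v w + X' x y (-N - p) q v w = -(_ • (Y y x (-N - q) p w v +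
    Y' y x (-N - q) p w v))
  rw [h, h', smul_add, neg_add]

theorem SkewPair.smul {X : Fam A M (GDual K P N)} {Y : Fam A P (GDual K M N)}
    (h : SkewPair N X Y) (c : K) : SkewPair N (c • X) (c • Y) := by
  intro x y p q v w
  change c • X x y (-N - p) q v w = -(_ • (c • Y y x (-N - q) p w v))
  rw [h, smul_neg, smul_comm]

theorem SkewPair.sub {X X' : Fam A M (GDual K P N)} {Y Y' : Fam A P (GDual K M N)}
    (h : SkewPair N X Y) (h' : SkewPair N X' Y') : SkewPair N (X - X') (Y - Y') := by
  rw [sub_eq_add_neg, sub_eq_add_neg, ← neg_one_smul K X', ← neg_one_smul K Y']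
  exact h.add (h'.smul _)

/-- A pairing determines its transpose. This converts skew symmetry into an equality of families
when the normal form is computed. -/
theorem SkewPair.unique {X : Fam A M (GDual K P N)} {Y Y' : Fam A P (GDual K M N)}
    (h : SkewPair N X Y) (h' : SkewPair N X Y') : Y = Y' := by
  funext x y p q
  ext v w
  obtain ⟨p, rfl⟩ : ∃ p', p = -N - p' := ⟨-N - p, by ring⟩
  rw [h.symm x y p q v w, h'.symm x y p q v w]

/-- Inserting `f` into one argument of a pairing is, after exchanging the arguments, the application
of `f^*` to the resulting functional. -/
theorem SkewPair.cmp {X : Fam A M (GDual K P N)} {Y : Fam A P (GDual K M N)} {f : Fam A M' M}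
    (h : SkewPair N X Y) (hX : X.IsRegular 0) (hY : Y.IsRegular 0) (hf : f.IsRegular 0) :
    SkewPair N (Fam.cmp 0 X f) (Fam.cmp 0 (Fam.dual N 0 f) Y) := by
  intro x y p q v w
  by_cases hq : q = wdeg x + (-N - p) + wdeg y
  · rw [cmp_eval, cmp_eval, splitSum_comm, ← splitSum_smul, ← splitSum_neg]
    refine splitSum_congr fun y₁ y₂ hy => ?_
    rw [← splitSum_smul, ← splitSum_neg]
    refine splitSum_congr fun x₁ x₂ hx => ?_
    rw [← hx, ← hy, wdeg_append, wdeg_append] at hq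
    rw [show wdeg x₂ + (-N - p) + wdeg y₁ + 0 = -N - (wdeg y₂ + (-N - q) + wdeg x₁ + 0) by lia,
      through_apply, through_apply, dual_apply, h, smul_neg]
    simp only [smul_smul, ← Int.negOnePow_add]
    congr 2
    rw [← hx, ← hy, wdeg_append, wdeg_append, hq]
    apply AInfBimodule.negOnePow_congr
    push_cast
    generalize (wdeg x₁ : ZMod 2) = a
    generalize (wdeg x₂ : ZMod 2) = a'
    generalize (wdeg y₁ : ZMod 2) = c
    generalize (wdeg y₂ : ZMod 2) = c'
    generalize (N : ZMod 2) = n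
    generalize (p : ZMod 2) = o
    revert a a' c c' n o
    decide
  · rw [(hX.cmp hf rfl).degree _ _ _ _ (by lia),
      ((hf.dual N 0).cmp hY rfl).degree _ _ _ _ (by lia)]
    simp

/-- Pulling back a pair of mutually transposed pairings in both arguments. -/
theorem SkewPair.pullback {Q' : ℤ → Type*} [∀ p, AddCommGroup (Q' p)] [∀ p, Module K (Q' p)]
    {X : Fam A M (GDual K P N)} {Y : Fam A P (GDual K M N)} {f : Fam A M' M} {g : Fam A Q' P}
    (h : SkewPair N X Y) (hX : X.IsRegular 0) (hY : Y.IsRegular 0) (hf : f.IsRegular 0)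
    (hg : g.IsRegular 0) :
    SkewPair N (Fam.cmp 0 (Fam.dual N 0 g) (Fam.cmp 0 X f))
      (Fam.cmp 0 (Fam.dual N 0 f) (Fam.cmp 0 Y g)) := by
  rw [← cmp_assoc (Fam.dual N 0 f) Y g (add_zero 0).symm]
  exact ((h.cmp hX hY hf).symm.cmp ((hf.dual N 0).cmp hY rfl) (hX.cmp hf rfl) hg).symm

end SkewPair

end Fam

/-! ### Homotopy transfer -/

namespace Fam

variable {K : Type u} [Field K] {A : AInfAlgebra.{u, v} K}
variable {M P : ℤ → Type*} [∀ p, AddCommGroup (M p)] [∀ p, Module K (M p)]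
  [∀ p, AddCommGroup (P p)] [∀ p, Module K (P p)]

theorem AgreeBelow.neg {n : ℕ} {f g : Fam A M P} (h : AgreeBelow n f g) :
    AgreeBelow n (-f) (-g) := fun x y hn => by
  simp only [Pi.neg_apply, h x y hn]

theorem bar_cmp_zero {Q : ℤ → Type*} [∀ p, AddCommGroup (Q p)] [∀ p, Module K (Q p)]
    (f : Fam A P Q) (g : Fam A M P) : bar (cmp 0 f g) = cmp 1 f (bar g) + cmp 0 (bar f) g := by
  rw [bar_cmp, Int.negOnePow_zero, one_smul, zero_add]

theorem bar_cmp_one {Q : ℤ → Type*} [∀ p, AddCommGroup (Q p)] [∀ p, Module K (Q p)]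
    (f : Fam A P Q) (g : Fam A M P) : bar (cmp 1 f g) = cmp 2 f (bar g) - cmp 1 (bar f) g := by
  rw [bar_cmp, Int.negOnePow_one, Units.neg_smul, one_smul, one_add_one_eq_two, sub_eq_add_neg]

/-- A family that starts with the identity is left cancellable. -/
theorem eq_zero_of_cmp_eq_zero {e : ℤ} {t : Fam A P P} {f : Fam A M P} (hf : f.HasDegree e)
    (ht : t [] [] = one A P [] []) (h : cmp e t f = 0) : f = 0 := by
  have key : f = -cmp e (t - one A P) f := by
    rw [cmp_sub_left, h, one_cmp hf, zero_sub, neg_neg]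
  refine eq_zero_of_agreeBelow f fun n hn => ?_
  have h0 := hn.cmp_right e (f := t - one A P) (by simp [ht])
  rw [cmp_zero_right] at h0
  rw [key]
  simpa using h0.neg

/-- Homotopy transfer: given a contraction `(ι, ρ, h)` of the complex underlying a bimodule `b`,
the equation `j = ι t - h (b - d) j` produces a map from a bimodule structure `β`. -/
theorem exists_transfer {b d h : Fam A M M} {ι : Fam A P M} {ρ : Fam A M P} {t : Fam A P P}
    {j : Fam A P M} (hb : b.IsRegular 1) (rel : bar b + cmp 1 b b = 0) (hd : d.IsRegular 1)
    (hbd : b [] [] = d [] []) (hρ : ρ.IsRegular 0) (bar_h : bar h = 0) (bar_ρ : bar ρ = 0)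
    (hh : cmp (-1) h h = 0) (hι : cmp 0 h ι = 0) (ρh : cmp (-1) ρ h = 0)
    (ρι : cmp 0 ρ ι = one A P) (ρd : cmp 1 ρ d = 0)
    (contraction : cmp (-1) d h + cmp 1 h d + cmp 0 ι ρ = one A M)
    (ht : t.IsRegular 0) (ht1 : t [] [] = one A P [] []) (hj : j.IsRegular 0)
    (j_eq : j = cmp 0 ι t - cmp 1 h (cmp 0 (b - d) j)) :
    ∃ β : Fam A P P, β.IsRegular 1 ∧ β [] [] = 0 ∧ bar β + cmp 1 β β = 0 ∧
      bar j + cmp 1 j β = cmp 0 b j := by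
  -- The side conditions on the contraction give `h j = 0` and `ρ j = t`, whatever the perturbation
  -- `b - d` is.
  have hj0 : cmp 0 h j = 0 := by
    rw [j_eq, cmp_sub_right, ← cmp_assoc h ι t (add_zero 0).symm, hι,
      ← cmp_assoc h h _ (add_neg_cancel 1).symm, hh, cmp_zero_left, cmp_zero_left, sub_zero]
  have ρj : cmp 0 ρ j = t := by
    rw [j_eq, cmp_sub_right, ← cmp_assoc ρ ι t (add_zero 0).symm, ρι,
      ← cmp_assoc ρ h _ (add_neg_cancel 1).symm, ρh, cmp_zero_left, one_cmp ht.degree, sub_zero]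
  have hbd0 : (b - d) [] [] = 0 := by simp [hbd]
  -- Applying `ρ` to the desired relation `bar j + j β = b j` forces `t β = ρ (b - d) j - bar t`. As
  -- `t - 1` has no constant part, this can be solved for `β` by iteration.
  obtain ⟨β, hβ, β_eq⟩ : ∃ β : Fam A P P, β.IsRegular 1 ∧
      cmp 1 ρ (cmp 0 (b - d) j) - bar t - cmp 1 (t - one A P) β = β := by
    refine exists_fixed _ _ (.zero 1) (fun f hf => ?_) .limit fun n f g _ _ hfg => ?_
    · exact ((hρ.cmp ((hb.sub hd).cmp hj (add_zero 1).symm) (zero_add 1).symm).sub ht.bar).sub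
        ((ht.sub .one).cmp hf (zero_add 1).symm)
    · exact (AgreeBelow.refl _ _).sub (hfg.cmp_right 1 (by simp [ht1]))
  have tβ : cmp 1 t β = cmp 1 ρ (cmp 0 (b - d) j) - bar t := by
    rw [cmp_sub_left 1 t, one_cmp hβ.degree] at β_eq
    rw [← sub_eq_zero]
    rw [← sub_eq_zero] at β_eq
    rw [← neg_eq_zero, ← β_eq]
    abel
  have hβ0 : β [] [] = 0 := by
    rw [← β_eq]
    funext p q
    simp [cmp_nil, bar_nil, hbd0, ht1]
  -- `E` measures the failure of `j` to be a bimodule map. It is shown to be killed by `h` and by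
  -- `ρ`, and then to vanish.
  set E := cmp 0 b j - cmp 1 j β - bar j with hE_def
  have hE : E.IsRegular 1 := ((hb.cmp hj (add_zero 1).symm).sub
    (hj.cmp hβ (zero_add 1).symm)).sub hj.bar
  have hE0 : cmp 1 h E = 0 := by
    have h1 : cmp 1 h (cmp 0 d j) = j - cmp 0 ι t := by
      rw [← cmp_assoc h d j (zero_add 1).symm, eq_sub_of_add_eq' (eq_sub_of_add_eq contraction),
        cmp_sub_left, cmp_sub_left, one_cmp hj.degree, cmp_assoc ι ρ j (add_zero 0).symm, ρj,
        cmp_assoc d h j (zero_add (-1)).symm, hj0, cmp_zero_right, sub_zero]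
    have h2 : cmp 1 h (cmp 0 (b - d) j) = cmp 0 ι t - j := by
      rw [← sub_eq_zero] at j_eq ⊢
      rw [← j_eq]
      abel
    have h3 : cmp 1 h (cmp 1 j β) = 0 := by
      rw [← cmp_assoc h j β (add_zero 1).symm, hj0, cmp_zero_left]
    have h4 : cmp 1 h (bar j) = 0 := by
      have := bar_cmp_zero h j
      rwa [hj0, bar_h, bar_zero, cmp_zero_left, add_zero, eq_comm] at this
    have h5 : cmp 0 b j = cmp 0 d j + cmp 0 (b - d) j := by rw [← cmp_add_left, add_sub_cancel]
    rw [hE_def, cmp_sub_right, cmp_sub_right, h5, cmp_add_right, h1, h2, h3, h4]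
    abel
  have ρE : cmp 1 ρ E = 0 := by
    have h1 : cmp 1 ρ (cmp 0 d j) = 0 := by
      rw [← cmp_assoc ρ d j (zero_add 1).symm, ρd, cmp_zero_left]
    have h3 : cmp 1 ρ (cmp 1 j β) = cmp 1 t β := by
      rw [← cmp_assoc ρ j β (add_zero 1).symm, ρj]
    have h4 : cmp 1 ρ (bar j) = bar t := by
      have := bar_cmp_zero ρ j
      rwa [ρj, bar_ρ, cmp_zero_left, add_zero, eq_comm] at this
    have h5 : cmp 0 b j = cmp 0 d j + cmp 0 (b - d) j := by rw [← cmp_add_left, add_sub_cancel]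
    rw [hE_def, cmp_sub_right, cmp_sub_right, h5, cmp_add_right, h1, h3, h4, tβ]
    abel
  set W := bar β + cmp 1 β β with hW_def
  have hW : W.IsRegular 2 := hβ.bar.add (hβ.cmp hβ rfl)
  -- The failure `W` of the relation for `β` is not yet known to vanish, but it enters only through
  -- `j W`, which `h` annihilates.
  have bE : cmp 1 b E = -bar E - cmp 1 E β - cmp 2 j W := by
    have h1 : cmp 1 b (cmp 0 b j) = -cmp 0 (bar b) j := by
      rw [← cmp_assoc b b j (zero_add 1).symm, eq_neg_of_add_eq_zero_right rel, cmp_neg_left]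
    have h2 : cmp 1 b (cmp 1 j β) = cmp 1 (cmp 0 b j) β :=
      (cmp_assoc b j β (add_zero 1).symm).symm
    have h3 : cmp 1 b (bar j) = bar (cmp 0 b j) - cmp 0 (bar b) j :=
      eq_sub_of_add_eq (bar_cmp_zero b j).symm
    have h4 : cmp 1 (cmp 1 j β) β = cmp 2 j (cmp 1 β β) := cmp_assoc j β β rfl
    rw [hW_def, cmp_add_right, hE_def, cmp_sub_right, cmp_sub_right, h1, h2, h3, cmp_sub_left,
      cmp_sub_left, h4, bar_sub, bar_sub, bar_bar hj.multilinear, bar_cmp_one]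
    abel
  have E_zero : E = 0 := by
    have h1 : cmp 2 h (bar E) = 0 := by
      have := bar_cmp_one h E
      rwa [hE0, bar_h, bar_zero, cmp_zero_left, sub_zero, eq_comm] at this
    have h2 : cmp 2 h (cmp 1 E β) = 0 := by
      rw [← cmp_assoc h E β one_add_one_eq_two.symm, hE0, cmp_zero_left]
    have h3 : cmp 2 h (cmp 2 j W) = 0 := by
      rw [← cmp_assoc h j W (add_zero 2).symm, hj0, cmp_zero_left]
    have h4 : cmp 1 d E = cmp 1 b E - cmp 1 (b - d) E := by rw [cmp_sub_left]; abel
    have h5 : cmp 2 h (cmp 1 b E) = 0 := by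
      rw [bE, cmp_sub_right, cmp_sub_right, cmp_neg_right, h1, h2, h3]
      simp
    -- Of the contraction identity applied to `E` only `h d E` survives, and `h b E = 0` turns it
    -- into `-h (b - d) E`. Since `b - d` consumes a letter, `E` vanishes by induction on word
    -- length.
    have key : E = -cmp 2 h (cmp 1 (b - d) E) := by
      conv_lhs => rw [← one_cmp hE.degree, ← contraction]
      rw [cmp_add_left, cmp_add_left, cmp_assoc d h E (add_neg_cancel 1).symm, hE0,
        cmp_assoc ι ρ E (add_zero 1).symm, ρE, cmp_assoc h d E one_add_one_eq_two.symm, h4,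
        cmp_sub_right, h5]
      simp
    refine eq_zero_of_agreeBelow E fun n hn => ?_
    have h6 := (AgreeBelow.refl _ h).cmp 2 (hn.cmp_right 1 hbd0)
    rw [cmp_zero_right, cmp_zero_right] at h6
    rw [key]
    simpa using h6.neg
  refine ⟨β, hβ, hβ0, ?_, ?_⟩
  -- With `E = 0` the formula for `b E` reduces to `j W = 0`; then `t W = ρ j W = 0`, and `t` can be
  -- cancelled.
  · have jW : cmp 2 j W = 0 := by
      rw [E_zero] at bE
      simpa using bE
    refine eq_zero_of_cmp_eq_zero hW.degree ht1 ?_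
    rw [← ρj, cmp_assoc ρ j W (add_zero 2).symm, jW, cmp_zero_right]
  · rw [eq_comm, ← sub_eq_zero, ← E_zero, hE_def]
    abel

end Fam

/-! ### Bimodules and their maps in the calculus of families -/

namespace AInfBimodule

variable {K : Type u} [Field K] {A : AInfAlgebra.{u, v} K}

theorem isRegular (C : AInfBimodule.{u, v, w} A) : C.b.IsRegular 1 :=
  ⟨C.multilinear, C.degree_one⟩

theorem bar_add_cmp (C : AInfBimodule.{u, v, w} A) : Fam.bar C.b + Fam.cmp 1 C.b C.b = 0 := by
  rw [← Fam.compHat_eq, C.relation]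

/-- Dualising `bar g + g b = b g` interchanges the two composites with `b`, so the relation for the
dual map holds for the negative of the plain dual of `b`. This is the constant `1` in the sign of
`dualOp`. -/
theorem dual_b (C : AInfBimodule.{u, v, w} A) (N : ℤ) : (C.dual N).b = -Fam.dual N 1 C.b := by
  funext x y p q
  ext φ w
  change C.dualOp N x y p q φ w = -Fam.dual N 1 C.b x y p q φ w
  rw [dualOp_apply, Fam.dual_apply, one_mul, add_assoc, add_comm, Int.negOnePow_succ,
    Units.neg_smul]

namespace Hom

variable {C : AInfBimodule.{u, v, w} A} {D : AInfBimodule.{u, v, w'} A}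

theorem isRegular (g : Hom C D) : g.f.IsRegular 0 := ⟨g.multilinear, g.degree_zero⟩

theorem bar_add_cmp (g : Hom C D) :
    Fam.bar g.f + Fam.cmp 1 g.f C.b = Fam.cmp 0 D.b g.f := by
  rw [← Fam.compHat_eq, g.commutes, Fam.comp_eq]

/-- A bimodule map from a regular family that satisfies the relation. -/
def ofRegular (f : Fam A C.carrier D.carrier) (hf : f.IsRegular 0)
    (h : Fam.bar f + Fam.cmp 1 f C.b = Fam.cmp 0 D.b f) : Hom C D where
  f := f
  multilinear := hf.multilinear
  degree_zero := hf.degree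
  commutes := by rw [Fam.compHat_eq, h, Fam.comp_eq]

/-- The composite of two bimodule maps. -/
def comp {E : AInfBimodule A} (g : Hom D E) (f : Hom C D) : Hom C E :=
  ofRegular (Fam.cmp 0 g.f f.f) (g.isRegular.cmp f.isRegular (add_zero 0).symm) <| by
    rw [Fam.bar_cmp_zero, Fam.cmp_assoc g.f f.f C.b (add_zero 1).symm, add_right_comm,
      ← Fam.cmp_add_right, f.bar_add_cmp, ← Fam.cmp_assoc g.f D.b f.f (zero_add 1).symm,
      ← Fam.cmp_add_left, add_comm, g.bar_add_cmp, Fam.cmp_assoc E.b g.f f.f (add_zero 0).symm]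

theorem dualMap_eq (g : Hom C D) (N : ℤ) : g.dualMap N = Fam.dual N 0 g.f := by
  funext x y p q
  rw [dualMap, Fam.dual, zero_mul, zero_add]

/-- The dual of a bimodule map, as a bimodule map. -/
def dual (g : Hom C D) (N : ℤ) : Hom (D.dual N) (C.dual N) :=
  ofRegular (Fam.dual N 0 g.f) (g.isRegular.dual N 0) <| by
    have h := congrArg (Fam.dual N 1) g.bar_add_cmp
    rw [Fam.dual_add, Fam.dual_bar, Fam.dual_cmp N g.isRegular C.isRegular (zero_add 1).symm,
      Fam.dual_cmp N D.isRegular g.isRegular (add_zero 1).symm, zero_mul, mul_zero,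
      Int.negOnePow_zero, one_smul, one_smul] at h
    rw [dual_b, dual_b, Fam.cmp_neg_left, Fam.cmp_neg_right, ← h]
    abel

end Hom

end AInfBimodule

/-! ### Normal form of a skew pairing -/

namespace Fam

variable {K : Type u} [Field K] {A : AInfAlgebra.{u, v} K}
variable {P : ℤ → Type*} [∀ p, AddCommGroup (P p)] [∀ p, Module K (P p)] {N : ℤ}

theorem IsRegular.const_nil_eq {Q : ℤ → Type*} [∀ p, AddCommGroup (Q p)] [∀ p, Module K (Q p)]
    {X : Fam A P Q} (hX : X.IsRegular 0) :
    Fam.const (A := A) (X [] []) = Fam.const (diag fun p => X [] [] p p) := by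
  congr 1
  funext p q
  by_cases h : p = q
  · subst h
    rw [diag_self]
  · rw [diag_of_ne _ h, hX.degree _ _ _ _ (by simp; lia)]

theorem SkewPair.const_nil {X : Fam A P (GDual K P N)} (h : SkewPair N X X) :
    SkewPair N (const (A := A) (X [] [])) (const (X [] [])) := by
  intro x y p q v w
  by_cases hxy : x = [] ∧ y = []
  · obtain ⟨rfl, rfl⟩ := hxy
    exact h [] [] p q v w
  · have hxy : x ≠ [] ∨ y ≠ [] := by tauto
    rw [const_of_ne _ hxy, const_of_ne _ hxy.symm]
    simp

/-- A skew symmetric pairing whose constant part is invertible is the pullback of its constant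
part. -/
theorem exists_normalization [CharZero K] {X : Fam A P (GDual K P N)} (hX : X.IsRegular 0)
    (skew : SkewPair N X X) {ψinv : Fam A (GDual K P N) P} (hinv : ψinv.IsRegular 0)
    (inv : cmp 0 (const (X [] [])) ψinv = one A (GDual K P N)) :
    ∃ t : Fam A P P, t.IsRegular 0 ∧ t [] [] = one A P [] [] ∧
      cmp 0 (dual N 0 t) (cmp 0 X t) = const (X [] []) := by
  set ψ : Fam A P (GDual K P N) := const (X [] []) with hψ_def
  have hψ : ψ.IsRegular 0 := by
    rw [hψ_def, hX.const_nil_eq]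
    exact .const_diag _
  have skewψ : SkewPair N ψ ψ := skew.const_nil
  set ρ := X - ψ with hρ_def
  have hρ : ρ.IsRegular 0 := hX.sub hψ
  have skewρ : SkewPair N ρ ρ := skew.sub skewψ
  have ρ0 : ρ [] [] = 0 := by simp [hρ_def, hψ_def]
  -- With `t = 1 + τ` and `X = ψ + ρ`, the expansion of `t^* X t` is `ψ + (ψ τ + τ^* ψ + S τ)`.
  let S (τ : Fam A P P) : Fam A P (GDual K P N) :=
    ρ + (cmp 0 ρ τ + cmp 0 (dual N 0 τ) ρ) + cmp 0 (dual N 0 τ) (cmp 0 X τ)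
  have regS : ∀ τ : Fam A P P, τ.IsRegular 0 → (S τ).IsRegular 0 := fun τ hτ =>
    (hρ.add ((hρ.cmp hτ rfl).add ((hτ.dual N 0).cmp hρ rfl))).add
      ((hτ.dual N 0).cmp (hX.cmp hτ (add_zero 0).symm) rfl)
  have dual0 : ∀ τ : Fam A P P, τ [] [] = 0 → dual N 0 τ [] [] = 0 := fun τ hτ => by
    funext p q
    simp only [dual_nil, hτ]
    ext
    simp
  have Xτ0 : ∀ τ : Fam A P P, τ [] [] = 0 → cmp 0 X τ [] [] = 0 := fun τ hτ => by
    funext p q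
    simp [cmp_nil, hτ]
  -- The correction is shared equally between the two linear terms: `ψ τ = -S τ / 2`, and skew
  -- symmetry of `S τ` gives the same value to `τ^* ψ`.
  obtain ⟨τ, ⟨hτ, τ0⟩, τ_eq⟩ : ∃ τ : Fam A P P, (τ.IsRegular 0 ∧ τ [] [] = 0) ∧
      cmp 0 ψinv ((-(1 / 2) : K) • S τ) = τ := by
    refine exists_fixed _ _ ⟨.zero 0, rfl⟩ (fun τ hτ => ⟨?_, ?_⟩) (fun τ h => ⟨?_, ?_⟩)
      fun n f g hf hg hfg => ?_
    · exact hinv.cmp ((regS τ hτ.1).smul _) rfl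
    · funext p q
      have hS0 : S τ [] [] p (p + 0) = 0 := by simp [cmp_nil, S, ρ0, hτ.2, dual0 τ hτ.2]
      rw [cmp_nil, Pi.smul_apply, Pi.smul_apply, Pi.smul_apply, Pi.smul_apply, hS0, smul_zero,
        LinearMap.comp_zero]
      rfl
    · exact .limit τ fun n => (h n).imp fun g hg => ⟨hg.1.1, hg.2⟩
    · obtain ⟨g, hg, hfg⟩ := h 1
      rw [hfg [] [] (by simp), hg.2]
    · refine (AgreeBelow.refl _ _).cmp 0 (AgreeBelow.smul (((AgreeBelow.refl _ _).add
        ((hfg.cmp_right 0 ρ0).add ((hfg.dual N 0).cmp_left 0 ρ0))).add ?_) _)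
      -- The quadratic term contains `X`, whose constant part is non-zero. It contracts because both
      -- factors `τ` lack a constant part, which is why that condition is carried through the
      -- iteration.
      exact (hfg.dual N 0).cmp_succ 0 ((AgreeBelow.refl _ _).cmp 0 hfg) (dual0 f hf.2)
        (dual0 g hg.2) (.inr ⟨Xτ0 f hf.2, Xτ0 g hg.2⟩)
  have ψτ : cmp 0 ψ τ = (-(1 / 2) : K) • S τ := by
    conv_lhs => rw [← τ_eq]
    rw [← cmp_assoc ψ ψinv _ (add_zero 0).symm, inv, one_cmp ((regS τ hτ).smul _).degree]
  have skewS : SkewPair N (S τ) (S τ) := by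
    have h1 := skewρ.cmp hρ hρ hτ
    have h2 := h1.add h1.symm
    rw [add_comm (cmp 0 (dual N 0 τ) ρ)] at h2
    exact (skewρ.add h2).add (skew.pullback hX hX hτ hτ)
  -- The transpose of `ψ τ` is `τ^* ψ`, while `S τ` is its own transpose.
  have τψ : cmp 0 (dual N 0 τ) ψ = (-(1 / 2) : K) • S τ := by
    refine (skewψ.cmp hψ hψ hτ).unique ?_
    rw [ψτ]
    exact skewS.smul _
  refine ⟨one A P + τ, IsRegular.one.add hτ, by simp [τ0], ?_⟩
  have hXψ : X = ψ + ρ := (add_sub_cancel ψ X).symm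
  have expand : cmp 0 (dual N 0 (one A P + τ)) (cmp 0 X (one A P + τ)) =
      ψ + (cmp 0 ψ τ + cmp 0 (dual N 0 τ) ψ + S τ) := by
    have hS : S τ = ρ + (cmp 0 ρ τ + cmp 0 (dual N 0 τ) ρ) +
      cmp 0 (dual N 0 τ) (cmp 0 X τ) := rfl
    have h1 : cmp 0 X τ = cmp 0 ψ τ + cmp 0 ρ τ := by rw [← cmp_add_left, ← hXψ]
    have h2 : cmp 0 (dual N 0 τ) X = cmp 0 (dual N 0 τ) ψ + cmp 0 (dual N 0 τ) ρ := by
      rw [← cmp_add_right, ← hXψ]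
    rw [dual_add, dual_one, cmp_add_left, cmp_add_right, cmp_one, cmp_add_right, cmp_add_right,
      one_cmp hX.degree, one_cmp (hX.cmp hτ (add_zero 0).symm).degree, h2, hS]
    generalize cmp 0 (dual N 0 τ) (cmp 0 X τ) = U
    rw [h1]
    nth_rw 1 [hXψ]
    abel
  rw [expand, ψτ, τψ, ← add_smul]
  have : (-(1 / 2) + -(1 / 2) : K) = -1 := by ring
  rw [this, neg_one_smul, neg_add_cancel, add_zero]

end Fam

/-! ### Contraction of a bimodule onto its cohomology -/

namespace AInfBimodule

variable {K : Type u} [Field K] {A : AInfAlgebra.{u, v} K} (C : AInfBimodule.{u, v, w} A)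

theorem mem_cycles_iff {p q : ℤ} (hq : p + 1 = q) (z : C.carrier p) :
    z ∈ C.cycles p ↔ C.b [] [] p q z = 0 := by
  subst hq
  rfl

theorem mem_boundaries_iff {p q : ℤ} (hq : q + 1 = p) (z : C.cycles p) :
    z ∈ C.boundaries p ↔ ∃ u : C.carrier q, C.b [] [] q p u = z := by
  obtain rfl : q = p - 1 := by lia
  rfl

theorem differential_mem_cycles (p q : ℤ) (u : C.carrier p) : C.b [] [] p q u ∈ C.cycles q := by
  by_cases hq : q = p + 1
  · subst hq
    have h := congrFun (congrFun (congrFun (congrFun C.bar_add_cmp []) []) p) (p + 1 + 1)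
    simp only [Pi.add_apply, Fam.bar_nil, Fam.cmp_nil, zero_add] at h
    exact LinearMap.congr_fun h u
  · rw [C.degree_one [] [] p q (by simpa using hq)]
    exact Submodule.zero_mem _

/-- A splitting of the complex underlying a bimodule over a field: a contraction to cohomology. -/
theorem exists_splitting :
    ∃ (i : ∀ p, C.Cohomology p →ₗ[K] C.carrier p) (r : ∀ p, C.carrier p →ₗ[K] C.Cohomology p)
      (h : ∀ p q, C.carrier p →ₗ[K] C.carrier q),
      (∀ p a, ∃ hc : i p a ∈ C.cycles p, Submodule.Quotient.mk ⟨i p a, hc⟩ = a) ∧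
      (∀ p a, r p (i p a) = a) ∧ (∀ p q, q ≠ p + -1 → h p q = 0) ∧
      (∀ p q c, r q (h p q c) = 0) ∧ (∀ p q a, h p q (i p a) = 0) ∧
      (∀ p q s c, h q s (h p q c) = 0) ∧ (∀ p q u, r q (C.b [] [] p q u) = 0) ∧
      ∀ p c, C.b [] [] (p + -1) p (h p (p + -1) c) + h (p + 1) p (C.b [] [] p (p + 1) c) +
        i p (r p c) = c := by
  have hπ : ∀ p, ∃ π : C.carrier p →ₗ[K] C.cycles p, ∀ z : C.cycles p, π z = z := fun p => by
    obtain ⟨π, hπ⟩ := (C.cycles p).subtype.exists_leftInverse_of_injective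
      (LinearMap.ker_eq_bot.2 (Submodule.subtype_injective _))
    exact ⟨π, LinearMap.congr_fun hπ⟩
  have hσ : ∀ p, ∃ σ : C.Cohomology p →ₗ[K] C.cycles p, ∀ a, (C.boundaries p).mkQ (σ a) = a :=
    fun p => by
      obtain ⟨σ, hσ⟩ := (C.boundaries p).mkQ.exists_rightInverse_of_surjective
        (LinearMap.range_eq_top.2 (Submodule.mkQ_surjective _))
      exact ⟨σ, LinearMap.congr_fun hσ⟩
  choose π hπ using hπ
  choose σ hσ using hσ
  -- A projection onto the boundaries: the cycle part minus the chosen representative of its class.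
  let W (p : ℤ) : C.carrier p →ₗ[K] C.cycles p := π p - σ p ∘ₗ (C.boundaries p).mkQ ∘ₗ π p
  have hW : ∀ p c, W p c = π p c - σ p ((C.boundaries p).mkQ (π p c)) := fun p c => rfl
  have πd : ∀ p q u, (C.boundaries q).mkQ (π q (C.b [] [] p q u)) = 0 := fun p q u => by
    have := hπ q ⟨_, C.differential_mem_cycles p q u⟩
    simp only at this
    rw [this, Submodule.mkQ_apply, Submodule.Quotient.mk_eq_zero]
    by_cases hq : p + 1 = q
    · exact (C.mem_boundaries_iff hq _).2 ⟨u, rfl⟩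
    · have h0 : C.b [] [] p q u = 0 := by
        rw [C.degree_one [] [] p q (by simpa using fun h => hq h.symm), LinearMap.zero_apply]
      have : (⟨_, C.differential_mem_cycles p q u⟩ : C.cycles q) = 0 := Subtype.ext h0
      rw [this]
      exact Submodule.zero_mem _
  -- In degree `-1` the homotopy is `(1 - π) s W`, with `s` a section of the differential over its
  -- range. It factors through `W` and lands in the kernel of `π`, whence all the side conditions.
  have hH : ∀ p q, ∃ h : C.carrier p →ₗ[K] C.carrier q, (q ≠ p + -1 → h = 0) ∧
      (∀ c, π q (h c) = 0) ∧ (∀ c, W p c = 0 → h c = 0) ∧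
      (q = p + -1 → ∀ c, C.b [] [] q p (h c) = W p c) ∧
      (q = p + -1 → ∀ u, h (C.b [] [] q p u) = u - π q u) := fun p q => by
    by_cases hq : q = p + -1
    · obtain ⟨s, hs⟩ := (C.b [] [] q p).rangeRestrict.exists_rightInverse_of_surjective
        (LinearMap.range_rangeRestrict _)
      have hs' : ∀ z, C.b [] [] q p (s z) = z := fun z =>
        congrArg Subtype.val (LinearMap.congr_fun hs z)
      have hWr : ∀ c, ((C.cycles p).subtype ∘ₗ W p) c ∈ LinearMap.range (C.b [] [] q p) := by
        intro c
        refine (C.mem_boundaries_iff (show q + 1 = p by lia) (W p c)).1 ?_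
        rw [← Submodule.Quotient.mk_eq_zero, ← Submodule.mkQ_apply, hW, map_sub, hσ, sub_self]
      have hbπ : ∀ u, C.b [] [] q p (π q u) = 0 := fun u =>
        (C.mem_cycles_iff (by lia) _).1 (π q u).2
      refine ⟨(LinearMap.id - (C.cycles q).subtype ∘ₗ π q) ∘ₗ s ∘ₗ
        (((C.cycles p).subtype ∘ₗ W p).codRestrict _ hWr), fun h => absurd hq h, fun c => ?_,
        fun c hc => ?_, fun _ c => ?_, fun _ u => ?_⟩
      · simp [hπ]
      · have : ((C.cycles p).subtype ∘ₗ W p).codRestrict _ hWr c = 0 := by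
          ext
          simp [hc]
        simp [this]
      · simp [hbπ, hs']
      · have h1 : (W p (C.b [] [] q p u) : C.carrier p) = C.b [] [] q p u := by
          rw [hW, πd, map_zero, sub_zero]
          exact congrArg Subtype.val (hπ p ⟨_, C.differential_mem_cycles q p u⟩)
        set z := ((C.cycles p).subtype ∘ₗ W p).codRestrict _ hWr (C.b [] [] q p u) with hz
        have hz' : C.b [] [] q p (s z - u) = 0 := by
          rw [map_sub, hs', sub_eq_zero]
          exact h1
        have h2 := congrArg Subtype.val (hπ q ⟨s z - u, (C.mem_cycles_iff (by lia) _).2 hz'⟩)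
        simp only [map_sub, Submodule.coe_sub] at h2
        change s z - (π q (s z) : C.carrier q) = _
        rw [sub_eq_sub_iff_sub_eq_sub, ← h2]
    · refine ⟨0, fun _ => rfl, fun c => ?_, fun c _ => rfl, fun h => absurd h hq,
        fun h => absurd h hq⟩
      simp
  choose h h0 h1 h2 h3 h4 using hH
  have hi : ∀ p a, π p (σ p a) = σ p a := fun p a => hπ p _
  refine ⟨fun p => (C.cycles p).subtype ∘ₗ σ p, fun p => (C.boundaries p).mkQ ∘ₗ π p, h,
    fun p a => ⟨(σ p a).2, hσ p a⟩, fun p a => ?_, h0, fun p q c => ?_, fun p q a => ?_,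
    fun p q s c => ?_, πd, fun p c => ?_⟩
  · simp [hi, hσ, -Submodule.mkQ_apply]
  · simp [h1]
  · refine h2 _ _ _ ?_
    rw [hW]
    simp [hi, hσ, -Submodule.mkQ_apply]
  · refine h2 _ _ _ ?_
    rw [hW, h1, map_zero, map_zero, sub_zero]
  · rw [h3 p _ rfl, h4 (p + 1) p (by lia), hW]
    simp

end AInfBimodule

namespace Fam

variable {K : Type u} [Field K] {A : AInfAlgebra.{u, v} K}
variable {M P : ℤ → Type*} [∀ p, AddCommGroup (M p)] [∀ p, Module K (M p)]
  [∀ p, AddCommGroup (P p)] [∀ p, Module K (P p)]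

theorem const_eq_zero {u : ∀ p q : ℤ, M p →ₗ[K] P q} (h : ∀ p q, u p q = 0) :
    const (A := A) u = 0 := by
  funext x y p q
  by_cases hxy : x = [] ∧ y = []
  · obtain ⟨rfl, rfl⟩ := hxy
    exact h p q
  · exact const_of_ne u (by tauto) p q

theorem const_add_const (u u' : ∀ p q : ℤ, M p →ₗ[K] P q) :
    const (A := A) u + const u' = const fun p q => u p q + u' p q := by
  funext x y p q
  by_cases hxy : x = [] ∧ y = []
  · obtain ⟨rfl, rfl⟩ := hxy
    rfl
  · have hxy : x ≠ [] ∨ y ≠ [] := by tauto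
    simp [const_of_ne _ hxy]

end Fam

/-! ### Homotopy inner products are skew and homologically non-degenerate -/

namespace AInfBimodule

variable {K : Type u} [Field K] {A : AInfAlgebra.{u, v} K}

theorem cmp_dual_cmp_nil_apply {M P : ℤ → Type*} [∀ p, AddCommGroup (M p)] [∀ p, Module K (M p)]
    [∀ p, AddCommGroup (P p)] [∀ p, Module K (P p)] {N : ℤ} (f g : Fam A M P)
    (X : Fam A P (Fam.GDual K P N)) (p : ℤ) (v : M p) (w : M (-N - p)) :
    Fam.cmp 0 (Fam.dual N 0 f) (Fam.cmp 0 X g) [] [] p p v w =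
      X [] [] p p (g [] [] p p v) (f [] [] (-N - p) (-N - p) w) := by
  rw [Fam.cmp_nil, Fam.cmp_nil, add_zero, Fam.dual_nil]
  rfl

namespace Hom

variable {C : AInfBimodule.{u, v, w} A} {N : ℤ}

/-- A map to the dual pairs cycles with boundaries trivially. -/
theorem form_boundary (φ : Hom C (C.dual N)) {p s : ℤ} (hs : s + 1 = -N - p) (z : C.cycles p)
    (u : C.carrier s) : φ.form [] [] p p z (C.b [] [] s (-N - p) u) = 0 := by
  obtain rfl : s = -N - (p + 1) := by lia
  -- As `φ_{0,0}` commutes with the differentials, `φ(z)` is a cycle of the dual, that is, a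
  -- functional vanishing on boundaries.
  have h := φ.comm_differential p (p + 1) rfl z
  rw [show C.b [] [] p (p + 1) z = 0 from z.2, map_zero] at h
  have h' := (LinearMap.congr_fun h u).symm
  change C.dualOp N [] [] p (p + 1) (φ.f [] [] p p z) u = 0 at h'
  rw [dualOp_apply, smul_eq_zero_iff_eq] at h'
  exact h'

theorem skewPair_iff (φ : Hom C (C.dual N)) : φ.IsSkew ↔ Fam.SkewPair N φ.f φ.f := Iff.rfl

theorem IsCyclicInnerProduct.skewPair {ψ : Hom C (C.dual N)} (h : ψ.IsCyclicInnerProduct) :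
    Fam.SkewPair N ψ.f ψ.f := by
  intro x y p q v w
  by_cases hxy : x = [] ∧ y = []
  · obtain ⟨rfl, rfl⟩ := hxy
    have := h.skew p q v w
    rw [wdeg_nil, zero_add, zero_add]
    exact this
  · rw [h.higher_eq_zero x y (by simpa using hxy),
      h.higher_eq_zero y x (by simpa using fun h1 h2 => hxy ⟨h2, h1⟩)]
    simp

/-- A cycle that pairs trivially with all cycles under a cyclic inner product is a boundary. -/
theorem IsCyclicInnerProduct.mem_boundaries {ψ : Hom C (C.dual N)} (h : ψ.IsCyclicInnerProduct)
    {p : ℤ} (z : C.cycles p) (hz : ∀ c : C.cycles (-N - p), ψ.form [] [] p p z c = 0) :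
    z ∈ C.boundaries p := by
  rw [C.mem_boundaries_iff (show p - 1 + 1 = p by lia)]
  -- A functional vanishing on the kernel of the differential factors through the differential. The
  -- resulting functional is `ψ(u)` for some `u`, and `z` is the differential of `u` up to sign.
  have hr : ψ.f [] [] p p z ∈ (C.b [] [] (-N - p) (-N - (p - 1))).dualMap.range := by
    rw [LinearMap.range_dualMap_eq_dualAnnihilator_ker, Submodule.mem_dualAnnihilator]
    intro c hc
    exact hz ⟨c, (C.mem_cycles_iff (by lia) c).2 hc⟩
  obtain ⟨l, hl⟩ := hr
  obtain ⟨u, rfl⟩ := (h.nondegenerate (p - 1)).2 l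
  have hu := ψ.comm_differential (p - 1) p (by lia) u
  have hu' : ψ.f [] [] p p (C.b [] [] (p - 1) p u) =
      (1 + (p - 1)).negOnePow • ψ.f [] [] p p z := by
    rw [hu]
    refine LinearMap.ext fun c => ?_
    change C.dualOp N [] [] (p - 1) p (ψ.f [] [] (p - 1) (p - 1) u) c = _
    rw [dualOp_apply, Fam.smul_functional_apply, ← hl]
    simp
  refine ⟨(1 + (p - 1)).negOnePow • u, (h.nondegenerate p).1 ?_⟩
  rw [LinearMap.map_smul_of_tower, LinearMap.map_smul_of_tower, hu', smul_smul,
    ← Int.negOnePow_add, Int.negOnePow_even _ (Even.add_self _), one_smul]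

theorem IsHomotopyInnerProduct.isSkew {φ : Hom C (C.dual N)} (h : φ.IsHomotopyInnerProduct) :
    φ.IsSkew := by
  obtain ⟨D, ψ, g, hψ, -, hφ⟩ := h
  rw [skewPair_iff, hφ, Fam.comp_eq, Fam.comp_eq, dualMap_eq]
  exact hψ.skewPair.pullback ψ.isRegular ψ.isRegular g.isRegular g.isRegular

/-- Every cycle of `D` is the image of a cycle of `C` up to a boundary, and boundaries pair
trivially with cycles. So if `a` pairs trivially with all cycles, `g(a)` does too; it is then a
boundary, and injectivity of `g` in cohomology kills the class of `a`. -/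
theorem IsHomotopyInnerProduct.isHomologicallyNondegenerate {φ : Hom C (C.dual N)}
    (h : φ.IsHomotopyInnerProduct) : φ.IsHomologicallyNondegenerate := by
  obtain ⟨D, ψ, g, hψ, hg, hφ⟩ := h
  intro p a ha
  by_contra! hb
  have hform : ∀ b : C.carrier (-N - p), φ.form [] [] p p a b =
      ψ.form [] [] p p (g.f [] [] p p a) (g.f [] [] (-N - p) (-N - p) b) := fun b => by
    unfold form
    rw [hφ, Fam.comp_eq, Fam.comp_eq, dualMap_eq]
    exact cmp_dual_cmp_nil_apply _ _ _ _ _ _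
  have hz : g.cyclesMap p a ∈ D.boundaries p := by
    refine hψ.mem_boundaries _ fun d => ?_
    obtain ⟨c, hc⟩ := (hg (-N - p)).2 (Submodule.Quotient.mk d)
    obtain ⟨c, rfl⟩ := Submodule.Quotient.mk_surjective _ c
    have hc' : g.cyclesMap (-N - p) c - d ∈ D.boundaries (-N - p) :=
      (Submodule.Quotient.eq _).1 hc
    obtain ⟨u, hu⟩ := (D.mem_boundaries_iff (show -N - p - 1 + 1 = -N - p by lia) _).1 hc'
    have h0 := ψ.form_boundary (show -N - p - 1 + 1 = -N - p by lia) (g.cyclesMap p a) u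
    rw [hu, Submodule.coe_sub] at h0
    have h1 : ψ.form [] [] p p (g.cyclesMap p a)
        (g.cyclesMap (-N - p) c : D.carrier (-N - p)) = 0 :=
      (hform c).symm.trans (hb c)
    have h2 : ψ.form [] [] p p (g.cyclesMap p a)
        ((g.cyclesMap (-N - p) c : D.carrier (-N - p)) - (d : D.carrier (-N - p))) =
        ψ.form [] [] p p (g.cyclesMap p a) (g.cyclesMap (-N - p) c : D.carrier (-N - p)) -
          ψ.form [] [] p p (g.cyclesMap p a) d := map_sub _ _ _
    rw [h2, h1, zero_sub, neg_eq_zero] at h0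
    exact h0
  refine ha ((hg p).1 ?_)
  rw [map_zero]
  exact (Submodule.Quotient.mk_eq_zero _).2 hz

/-! ### Construction of a homotopy inner product -/

/-- The inverse of a bimodule map without higher components is a bimodule map. -/
theorem exists_inverse {D E : AInfBimodule A} (ψ : Hom D E) (hψ : Fam.bar ψ.f = 0)
    {χ : Fam A E.carrier D.carrier} (hχ : χ.IsRegular 0) (bar_χ : Fam.bar χ = 0)
    (h₁ : Fam.cmp 0 ψ.f χ = Fam.one A E.carrier) (h₂ : Fam.cmp 0 χ ψ.f = Fam.one A D.carrier) :
    ∃ χ' : Hom E D, χ'.f = χ := by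
  refine ⟨ofRegular χ hχ ?_, rfl⟩
  have h := ψ.bar_add_cmp
  rw [hψ, zero_add] at h
  have hb : Fam.cmp 1 χ (Fam.cmp 0 E.b (Fam.cmp 0 ψ.f χ)) = Fam.cmp 0 D.b χ := by
    rw [← Fam.cmp_assoc E.b ψ.f χ (add_zero 0).symm, ← h,
      Fam.cmp_assoc ψ.f D.b χ (zero_add 1).symm, ← Fam.cmp_assoc χ ψ.f _ (add_zero 1).symm, h₂,
      Fam.one_cmp (D.isRegular.cmp hχ (add_zero 1).symm).degree]
  rwa [h₁, Fam.cmp_one, ← zero_add (Fam.cmp 1 χ E.b), ← bar_χ] at hb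

/-- A skew symmetric homologically non-degenerate map to the dual gives a homotopy inner product. -/
theorem exists_isHomotopyInnerProduct [CharZero K]
    (hC : ∀ p : ℤ, FiniteDimensional K (C.Cohomology p)) (φ : Hom C (C.dual N)) (skew : φ.IsSkew)
    (nondeg : φ.IsHomologicallyNondegenerate) :
    ∃ φ' : Hom C (C.dual N), φ'.IsHomotopyInnerProduct := by
  obtain ⟨i₀, r, h, i₀_class, ri, h_deg, rh, hi, hh, rd, contr⟩ := C.exists_splitting
  -- By the contraction identity a cycle is its chosen representative plus a boundary, so
  -- non-degeneracy need only be tested on the representatives `i₀ w`.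
  have class_eq_zero : ∀ (p : ℤ) (z : C.cycles p),
      (∀ w, φ.form [] [] p p z (i₀ (-N - p) w) = 0) →
      (Submodule.Quotient.mk z : C.Cohomology p) = 0 := fun p z hz => by
    by_contra hne
    obtain ⟨c, hc⟩ := nondeg p z hne
    refine hc ?_
    have h1 := contr (-N - p) c
    rw [show C.b [] [] (-N - p) (-N - p + 1) c = 0 from c.2, map_zero, add_zero] at h1
    have h2 : ∀ c₁ c₂, φ.form [] [] p p z (c₁ + c₂) =
        φ.form [] [] p p z c₁ + φ.form [] [] p p z c₂ := map_add _
    rw [← h1, h2, hz, add_zero]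
    exact φ.form_boundary (by lia) z _
  let d : Fam A C.carrier C.carrier := .const (C.b [] [])
  let η : Fam A C.carrier C.carrier := .const h
  let ι : Fam A C.Cohomology C.carrier := .const (Fam.diag i₀)
  let ρ : Fam A C.carrier C.Cohomology := .const (Fam.diag r)
  have hd : d.IsRegular 1 := .const fun p q hq => C.degree_one [] [] p q (by simpa using hq)
  have hη : η.IsRegular (-1) := .const h_deg
  have hι : ι.IsRegular 0 := .const_diag i₀
  have hbd : (C.b - d) [] [] = 0 := sub_self (C.b [] [])
  -- No bimodule structure on the cohomology is needed here: `i` only serves to pull `φ` back, and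
  -- the structure is transferred after normalisation.
  obtain ⟨i, hi_reg, i_eq⟩ : ∃ i : Fam A C.Cohomology C.carrier, i.IsRegular 0 ∧
      ι - Fam.cmp 1 η (Fam.cmp 0 (C.b - d) i) = i := by
    refine Fam.exists_fixed _ _ (.zero 0) (fun f hf => ?_) .limit fun n f g _ _ hfg => ?_
    · exact hι.sub (hη.cmp ((C.isRegular.sub hd).cmp hf (add_zero 1).symm) (neg_add_cancel 1).symm)
    · exact (Fam.AgreeBelow.refl _ _).sub
        ((Fam.AgreeBelow.refl _ _).cmp 1 (hfg.cmp_right 0 hbd))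
  have i_nil : ∀ p, i [] [] p p = i₀ p := fun p => by
    rw [← i_eq]
    have : Fam.cmp 1 η (Fam.cmp 0 (C.b - d) i) [] [] p p = 0 := by
      simp [Fam.cmp_nil, hbd]
    change ι [] [] p p - Fam.cmp 1 η (Fam.cmp 0 (C.b - d) i) [] [] p p = _
    rw [this, sub_zero]
    exact Fam.diag_self i₀ p
  let X : Fam A C.Cohomology (Fam.GDual K C.Cohomology N) :=
    Fam.cmp 0 (Fam.dual N 0 i) (Fam.cmp 0 φ.f i)
  have hX : X.IsRegular 0 :=
    (hi_reg.dual N 0).cmp (φ.isRegular.cmp hi_reg (add_zero 0).symm) (add_zero 0).symm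
  have X_skew : Fam.SkewPair N X X :=
    Fam.SkewPair.pullback skew φ.isRegular φ.isRegular hi_reg hi_reg
  have X_nil : ∀ p a w, X [] [] p p a w = φ.form [] [] p p (i₀ p a) (i₀ (-N - p) w) :=
    fun p a w => by
      refine (cmp_dual_cmp_nil_apply i i φ.f p a w).trans ?_
      rw [i_nil, i_nil]
      rfl
  have X_inj : ∀ p, Function.Injective (X [] [] p p) := fun p => by
    refine (injective_iff_map_eq_zero _).2 fun a ha => ?_
    obtain ⟨hc, hca⟩ := i₀_class p a
    rw [← hca]
    refine class_eq_zero p _ fun w => ?_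
    rw [← X_nil, ha]
    rfl
  -- Injectivity in the degrees `p` and `-N - p` bounds each of the two finite dimensions by the
  -- other, so an injection into the dual is bijective.
  have X_bij : ∀ p, Function.Bijective (X [] [] p p) := fun p => by
    have h1 : ∀ p, Module.finrank K (C.Cohomology p) ≤ Module.finrank K (C.Cohomology (-N - p)) :=
      fun p => (LinearMap.finrank_le_finrank_of_injective (X_inj p)).trans_eq
        Subspace.dual_finrank_eq
    have h2 := h1 (-N - p)
    rw [sub_sub_cancel] at h2
    refine ⟨X_inj p, (LinearMap.injective_iff_surjective_of_finrank_eq_finrank ?_).1 (X_inj p)⟩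
    exact (le_antisymm (h1 p) h2).trans Subspace.dual_finrank_eq.symm
  let e (p : ℤ) : C.Cohomology p ≃ₗ[K] Fam.GDual K C.Cohomology N p :=
    LinearEquiv.ofBijective (X [] [] p p) (X_bij p)
  let χ : Fam A (Fam.GDual K C.Cohomology N) C.Cohomology :=
    .const (Fam.diag fun p => ((e p).symm : Fam.GDual K C.Cohomology N p →ₗ[K] C.Cohomology p))
  have hχ : χ.IsRegular 0 := .const_diag _
  have χ_nil : ∀ p f, χ [] [] p p f = (e p).symm f := fun p f =>
    LinearMap.congr_fun (Fam.diag_self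
      (fun p => ((e p).symm : Fam.GDual K C.Cohomology N p →ₗ[K] C.Cohomology p)) p) f
  have inv₁ : Fam.cmp 0 (Fam.const (X [] [])) χ = Fam.one A _ := by
    rw [hX.const_nil_eq, Fam.const_diag_cmp, Fam.one]
    congr 2
    funext p
    exact LinearMap.ext fun f => (e p).apply_symm_apply f
  have inv₂ : Fam.cmp 0 χ (Fam.const (X [] [])) = Fam.one A _ := by
    rw [hX.const_nil_eq, Fam.const_diag_cmp, Fam.one]
    congr 2
    funext p
    exact LinearMap.ext fun f => (e p).symm_apply_apply f
  obtain ⟨t, ht, t_nil, t_eq⟩ := Fam.exists_normalization hX X_skew hχ inv₁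
  let j : Fam A C.Cohomology C.carrier := Fam.cmp 0 i t
  have hj : j.IsRegular 0 := hi_reg.cmp ht (add_zero 0).symm
  -- Precomposition with `t` turns the equation for `i` into the one that transfer requires of `j`,
  -- with `ι t` as its starting term.
  have j_eq : j = Fam.cmp 0 ι t - Fam.cmp 1 η (Fam.cmp 0 (C.b - d) j) := by
    change Fam.cmp 0 i t = _
    nth_rw 1 [← i_eq]
    rw [Fam.cmp_sub_left, Fam.cmp_assoc η _ t (zero_add 1).symm,
      Fam.cmp_assoc (C.b - d) i t (add_zero 0).symm]
  have j_nil : ∀ p, j [] [] p p = i₀ p := fun p => by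
    change Fam.cmp 0 i t [] [] p p = _
    rw [Fam.cmp_nil, add_zero, t_nil, Fam.one_nil, i_nil, LinearMap.comp_id]
  have ηη : Fam.cmp (-1) η η = 0 := by
    rw [Fam.const_cmp_const]
    exact Fam.const_eq_zero fun p q => LinearMap.ext fun c => hh _ _ _ c
  have ηι : Fam.cmp 0 η ι = 0 := by
    rw [Fam.const_cmp_const]
    refine Fam.const_eq_zero fun p q => LinearMap.ext fun c => ?_
    rw [add_zero, Fam.diag_self]
    exact hi _ _ c
  have diag_comp : ∀ (s q : ℤ) (c : C.carrier s), r s c = 0 → Fam.diag r s q c = 0 :=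
    fun s q c hc => by
      by_cases hs : s = q
      · subst hs
        rwa [Fam.diag_self]
      · rw [Fam.diag_of_ne _ hs, LinearMap.zero_apply]
  have ρη : Fam.cmp (-1) ρ η = 0 := by
    rw [Fam.const_cmp_const]
    exact Fam.const_eq_zero fun p q => LinearMap.ext fun c => diag_comp _ _ _ (rh _ _ c)
  have ρd' : Fam.cmp 1 ρ d = 0 := by
    rw [Fam.const_cmp_const]
    exact Fam.const_eq_zero fun p q => LinearMap.ext fun c => diag_comp _ _ _ (rd _ _ c)
  have ρι : Fam.cmp 0 ρ ι = Fam.one A _ := by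
    rw [Fam.const_diag_cmp, Fam.one]
    congr 2
    funext p
    exact LinearMap.ext (ri p)
  have contraction : Fam.cmp (-1) d η + Fam.cmp 1 η d + Fam.cmp 0 ι ρ = Fam.one A _ := by
    rw [Fam.const_cmp_const, Fam.const_cmp_const, Fam.const_diag_cmp, Fam.const_add_const,
      Fam.const_add_const, Fam.one]
    congr 1
    funext p q
    by_cases hq : p = q
    · subst hq
      rw [Fam.diag_self, Fam.diag_self]
      exact LinearMap.ext (contr p)
    · rw [Fam.diag_of_ne _ hq, Fam.diag_of_ne _ hq, h_deg (p + 1) q (by lia),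
        C.degree_one [] [] (p + -1) q (by simpa using Ne.symm hq)]
      simp
  obtain ⟨β, hβ, β_nil, β_rel, β_hom⟩ := Fam.exists_transfer (h := η) (ι := ι) (ρ := ρ) (t := t)
    C.isRegular C.bar_add_cmp hd rfl (.const_diag r) (Fam.bar_const _) (Fam.bar_const _)
    ηη ηι ρη ρι ρd' contraction ht t_nil hj j_eq
  let D : AInfBimodule.{u, v, w} A :=
    { carrier := C.Cohomology
      b := β
      multilinear := hβ.multilinear
      degree_one := hβ.degree
      relation := by rw [Fam.compHat_eq, β_rel] }
  let J : Hom D C := ofRegular j hj β_hom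
  -- `Ψ = (i t)^* φ (i t) = t^* X t`, which is constant by the choice of `t`.
  let Ψ : Hom D (D.dual N) := (J.dual N).comp (φ.comp J)
  have Ψ_eq : Ψ.f = Fam.const (X [] []) := by
    rw [← t_eq]
    change Fam.cmp 0 (Fam.dual N 0 (Fam.cmp 0 i t)) (Fam.cmp 0 φ.f (Fam.cmp 0 i t)) = _
    rw [Fam.dual_cmp N hi_reg ht (add_zero 0).symm, zero_mul, Int.negOnePow_zero, one_smul,
      Fam.cmp_assoc _ _ _ (add_zero 0).symm, ← Fam.cmp_assoc φ.f i t (add_zero 0).symm,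
      ← Fam.cmp_assoc (Fam.dual N 0 i) _ t (add_zero 0).symm]
  obtain ⟨Χ, hΧ⟩ := exists_inverse Ψ (χ := χ) (by rw [Ψ_eq]; exact Fam.bar_const _) hχ
    (Fam.bar_const _) (by rw [Ψ_eq]; exact inv₁) (by rw [Ψ_eq]; exact inv₂)
  -- `J` points from `D` to `C`. A map in the required direction is obtained through the duals, as
  -- `C → C^* → D^* → D`, with `Ψ` inverted in the last step.
  let g : Hom C D := Χ.comp ((J.dual N).comp φ)
  have g_nil : ∀ p z, e p (g.f [] [] p p z) = (i₀ (-N - p)).dualMap (φ.f [] [] p p z) :=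
    fun p z => by
      have : g.f [] [] p p z = (e p).symm ((i₀ (-N - p)).dualMap (φ.f [] [] p p z)) := by
        change Fam.cmp 0 Χ.f (Fam.cmp 0 (Fam.dual N 0 j) φ.f) [] [] p p z = _
        rw [hΧ, Fam.cmp_nil, Fam.cmp_nil, add_zero, Fam.dual_nil, j_nil]
        exact χ_nil p _
      rw [this, LinearEquiv.apply_symm_apply]
  refine ⟨(g.dual N).comp (Ψ.comp g), D, Ψ, g, ⟨fun x y hxy p q => ?_, fun p q v w => ?_,
    fun p => ?_⟩, fun p => ⟨?_, ?_⟩, ?_⟩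
  · rw [Ψ_eq]
    exact Fam.const_of_ne _ (by rw [ne_eq, Prod.mk.injEq] at hxy; tauto) p q
  · have := X_skew.const_nil [] [] p q v w
    rw [← Ψ_eq, wdeg_nil, zero_add, zero_add] at this
    exact this
  · rw [Ψ_eq]
    exact X_bij p
  -- The differential of `D` is zero, so a vanishing class means `g(z) = 0`; then `φ(z)` vanishes on
  -- all representatives.
  · refine (injective_iff_map_eq_zero _).2 fun a ha => ?_
    obtain ⟨z, rfl⟩ := Submodule.Quotient.mk_surjective _ a
    obtain ⟨u, hu⟩ := (D.mem_boundaries_iff (show p - 1 + 1 = p by lia) _).1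
      ((Submodule.Quotient.mk_eq_zero _).1 ha)
    have hu0 : g.f [] [] p p z = 0 := by
      refine hu.symm.trans ?_
      change β [] [] (p - 1) p u = 0
      rw [β_nil]
      rfl
    refine class_eq_zero p z fun w => ?_
    have := g_nil p z
    rw [hu0, map_zero] at this
    exact (LinearMap.congr_fun this w).symm
  -- The representative `i₀ a` maps exactly to `a`, since `φ(i₀ a)` restricted to representatives is
  -- `X_{0,0}(a)`.
  · intro a
    obtain ⟨a, rfl⟩ := Submodule.Quotient.mk_surjective _ a
    obtain ⟨hc, -⟩ := i₀_class p a
    refine ⟨Submodule.Quotient.mk ⟨i₀ p a, hc⟩, congrArg Submodule.Quotient.mk (Subtype.ext ?_)⟩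
    refine (e p).injective ((g_nil p _).trans ?_)
    exact LinearMap.ext fun w => (X_nil p a w).symm
  · rw [Fam.comp_eq, Fam.comp_eq, dualMap_eq]
    rfl

end Hom

end AInfBimodule

theorem theorem4p1 {K : Type u} [Field K] [CharZero K] (A : AInfAlgebra.{u, v} K)
    (C : AInfBimodule.{u, v, w} A) (N : ℤ)
    (hC : ∀ p : ℤ, FiniteDimensional K (C.Cohomology p)) :
    (∃ φ : C.Hom (C.dual N), φ.IsHomotopyInnerProduct) ↔
      ∃ φ : C.Hom (C.dual N), φ.IsSkew ∧ φ.IsHomologicallyNondegenerate :=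
  ⟨fun ⟨φ, hφ⟩ => ⟨φ, hφ.isSkew, hφ.isHomologicallyNondegenerate⟩,
    fun ⟨φ, skew, nondeg⟩ => AInfBimodule.Hom.exists_isHomotopyInnerProduct hC φ skew nondeg⟩
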